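/- Let $(\Sigma,\mathcal T)$ be an ideally triangulated compact $3$-manifold with boundary: $\mathcal T$ glues finitely many tetrahedra in pairs along all their faces, no edge being identified with its own reverse, and $\Sigma$ is the glued space with open stars of the vertices removed. Let $V$ be the set of vertices; the boundary component $\Sigma_i$ of $\Sigma$ at $i\in V$ is the link of $i$, a closed surface triangulated by the vertex triangles (corners of tetrahedra) at $i$. Let $\chi(\Sigma_i)$ be its Euler characteristic and let the degree $d_i$ be the number of its vertex triangles. A (non-degenerate) generalized sphere packing metric is a function $r:V\to(0,\infty)$ such that for every tetrahedron of $\mathcal T$ there is a non-degenerate hyper-ideal tetrahedron in $\mathbb H^3$ whose edge lengths are $l_{ij}=r_i+r_j$. Its combinatorial scalar curvature is $$K_i(r)=\sum_{e}\Bigl(2\pi-\sum\beta\Bigr),$$ where $e$ runs over the edges at $i$ (an edge with both ends at $i$ being counted twice) and the inner sum is over the dihedral angles $\beta$ at $e$ of the tetrahedra around $e$. Given $\bar K\in\mathbb R^V$ and an initial generalized sphere packing metric $r_0$, the combinatorial Ricci flow is $$\frac{dr_i}{dt}=K_i(r(t))-\bar K_i\quad(i\in V),\qquad r(0)=r_0,$$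 for $r(t)$ in the set of generalized sphere packing metrics. For $0<c<M$, $\chi \in \mathbb Z$ and $d \in \mathbb N$ put $$C_1(\chi,d,M)=2\pi\chi+d\Bigl(\pi-3\arccos\frac{1+\tanh^2M}{1+3\tanh^2M}\Bigr),$$ $$C_2(\chi,d,M,c)=2\pi\chi+d\Bigl(\pi-3\arccos\Bigl(\frac12+\frac{1-\tanh^2c}{2(1+\tanh^2M+2\tanh c\,\tanh M)}\Bigr)\Bigr).$$ **Theorem 1.5.** Suppose that there is a generalized sphere packing metric $\bar r$ with $K(\bar r)=\bar K$. Then, for every initial metric $r_0$, the combinatorial Ricci flow has a solution on some interval $[0,\tau)$, $\tau>0$, and any two solutions on the same interval $[0,\tau)$ agree. Moreover: (a) The solution is uniformly bounded from above: there is a constant $M>0$ such that $r_i(t)\le M$ for all $i\in V$ and all $t \ge 0$ for which the solution exists. (b) Let $M>0$ be any constant as in (a) and let $c\in(0,M)$. Then $C_1(\chi(\Sigma_i),d_i,M)<C_2(\chi(\Sigma_i),d_i,M,c)$ for all $i\in V$, and if $\bar K_i\in\bigl(C_1(\chi(\Sigma_i),d_i,M),\,C_2(\chi(\Sigma_i),d_i,M,c)\bigr]$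 for all $i\in V$, then the solution of the combinatorial Ricci flow exists for all $t\ge0$ and converges exponentially fast to $\bar r$: there are $A,\lambda>0$ with $|r_i(t)-\bar r_i|\le A e^{-\lambda t}$ for all $t\ge0$ and $i\in V$. -/

import Mathlib

open Real

/-! ### Hyper-ideal tetrahedra in hyperbolic 3-space (hyperboloid model) -/

/-- The Lorentzian inner product of signature `(3,1)` on `ℝ⁴`. Hyperbolic 3-space is one sheet of
`{x | ⟪x, x⟫ = -1}`, with distance `d(x, y) = arcosh (-⟪x, y⟫)`. -/
def lorentz (x y : Fin 4 → ℝ) : ℝ := x 0 * y 0 + x 1 * y 1 + x 2 * y 2 - x 3 * y 3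

/-- The smallest index different from `i` and `j`. -/
def firstOther (i j : Fin 4) : Fin 4 :=
  if i ≠ 0 ∧ j ≠ 0 then 0 else if i ≠ 1 ∧ j ≠ 1 then 1 else 2

/-- The largest index different from `i` and `j`. -/
def lastOther (i j : Fin 4) : Fin 4 :=
  if i ≠ 3 ∧ j ≠ 3 then 3 else if i ≠ 2 ∧ j ≠ 2 then 2 else 1

theorem firstOther_lastOther_spec : ∀ i j : Fin 4, i ≠ j →
    firstOther i j ≠ i ∧ firstOther i j ≠ j ∧ lastOther i j ≠ i ∧ lastOther i j ≠ j ∧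
      firstOther i j ≠ lastOther i j := by
  decide

/-- A (non-degenerate, labelled) hyper-ideal tetrahedron. In the Klein model it is a tetrahedron
whose four vertices lie outside the closed ball and whose edges meet the open ball, truncated by
the polar planes of its vertices. The hyper-ideal vertices are represented by unit space-like
vectors `v i`. The condition `⟪v i, v j⟫ < -1` says that the segment from `v i` to `v j` meets
hyperbolic space (equivalently, `v i + v j` is time-like) and that the truncating planes
`(v i)^⊥` and `(v j)^⊥` are disjoint. Linear independence says that the tetrahedron is not flat.
The truncated tetrahedron consists of the points `x` of hyperbolic space in the cone spanned by
the `v i` with `⟪x, v i⟫ ≤ 0` for all `i`; its vertex triangle `Δ i` lies in `(v i)^⊥`. -/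
structure HyperidealTetrahedron where
  v : Fin 4 → (Fin 4 → ℝ)
  nondegenerate : LinearIndependent ℝ v
  unit : ∀ i, lorentz (v i) (v i) = 1
  meets : ∀ i j, i ≠ j → lorentz (v i) (v j) < -1

namespace HyperidealTetrahedron

/-- The point of hyperbolic space where the edge `{ij}` ends on the vertex triangle `Δ i`: the
normalized component of `v j` orthogonal to `v i`. -/
noncomputable def endpoint (P : HyperidealTetrahedron) (i j : Fin 4) : Fin 4 → ℝ :=
  (√(lorentz (P.v i) (P.v j) ^ 2 - 1))⁻¹ • (P.v j - lorentz (P.v i) (P.v j) • P.v i)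

/-- The length of the edge `{ij}`, i.e. the hyperbolic distance of its two end points. -/
noncomputable def length (P : HyperidealTetrahedron) (i j : Fin 4) : ℝ :=
  arcosh (-lorentz (P.endpoint i j) (P.endpoint j i))

/-- The component of `v k` orthogonal to the plane spanned by `v i` and `v j`: for every point of
the edge `{ij}`, this is a tangent vector which is orthogonal to the edge and points into the
face `{ijk}`. -/
noncomputable def normalPart (P : HyperidealTetrahedron) (i j k : Fin 4) : Fin 4 → ℝ :=
  P.v k
    - ((lorentz (P.v k) (P.v i) - lorentz (P.v i) (P.v j) * lorentz (P.v k) (P.v j))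
        / (1 - lorentz (P.v i) (P.v j) ^ 2)) • P.v i
    - ((lorentz (P.v k) (P.v j) - lorentz (P.v i) (P.v j) * lorentz (P.v k) (P.v i))
        / (1 - lorentz (P.v i) (P.v j) ^ 2)) • P.v j

/-- The dihedral angle `β_{ij,kh}` at the edge `{ij}`, `{k, h}` being the other two vertices: the
angle between the faces `{ijk}` and `{ijh}`. -/
noncomputable def dihedral (P : HyperidealTetrahedron) (i j : Fin 4) : ℝ :=
  arccos
    (lorentz (P.normalPart i j (firstOther i j)) (P.normalPart i j (lastOther i j)) /
      (√(lorentz (P.normalPart i j (firstOther i j)) (P.normalPart i j (firstOther i j))) *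
        √(lorentz (P.normalPart i j (lastOther i j)) (P.normalPart i j (lastOther i j)))))

/-- The tetrahedron has the edge lengths `l i j`. -/
def HasLengths (P : HyperidealTetrahedron) (l : Fin 4 → Fin 4 → ℝ) : Prop :=
  ∀ i j, i ≠ j → P.length i j = l i j

end HyperidealTetrahedron

theorem lorentz_comm (x y : Fin 4 → ℝ) : lorentz x y = lorentz y x := by
  simp only [lorentz]; ring

theorem lorentz_comb (a b a' b' : ℝ) (x y z w : Fin 4 → ℝ) :
    lorentz (x - a • y - b • z) (w - a' • y - b' • z) =
      lorentz x w - a' * lorentz x y - b' * lorentz x z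
        - a * lorentz y w + a * a' * lorentz y y + a * b' * lorentz y z
        - b * lorentz z w + b * a' * lorentz z y + b * b' * lorentz z z := by
  simp only [lorentz, Pi.sub_apply, Pi.smul_apply, smul_eq_mul]; ring

namespace HyperidealTetrahedron

/-- The edge length is also the distance of the two truncating planes. -/
theorem cosh_length (P : HyperidealTetrahedron) {i j : Fin 4} (h : i ≠ j) :
    cosh (P.length i j) = -lorentz (P.v i) (P.v j) := by
  have hg := P.meets i j h
  have hi := P.unit i
  have hj := P.unit j
  have hji := lorentz_comm (P.v j) (P.v i)
  have key : lorentz (P.endpoint i j) (P.endpoint j i) = lorentz (P.v i) (P.v j) := by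
    have hpos : 0 < lorentz (P.v i) (P.v j) ^ 2 - 1 := by nlinarith
    have hs := Real.mul_self_sqrt hpos.le
    have hs0 := (Real.sqrt_pos.2 hpos).ne'
    have e : lorentz (P.endpoint i j) (P.endpoint j i) =
        (√(lorentz (P.v i) (P.v j) ^ 2 - 1))⁻¹ * (√(lorentz (P.v i) (P.v j) ^ 2 - 1))⁻¹ *
          (lorentz (P.v i) (P.v j) * (lorentz (P.v i) (P.v j) ^ 2 - 1)) := by
      have : lorentz (P.endpoint i j) (P.endpoint j i) =
        (√(lorentz (P.v i) (P.v j) ^ 2 - 1))⁻¹ * (√(lorentz (P.v i) (P.v j) ^ 2 - 1))⁻¹ *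
          (lorentz (P.v j) (P.v i) - lorentz (P.v i) (P.v j) * lorentz (P.v j) (P.v j)
            - lorentz (P.v i) (P.v j) * lorentz (P.v i) (P.v i)
            + lorentz (P.v i) (P.v j) ^ 2 * lorentz (P.v i) (P.v j)) := by
        unfold endpoint
        rw [hji]
        simp only [lorentz, Pi.sub_apply, Pi.smul_apply, smul_eq_mul]
        ring
      rw [this, hi, hj, hji]; ring
    rw [e, ← mul_inv, hs]
    field_simp
  rw [length, key, Real.cosh_arcosh (by linarith)]

/-- A hyper-ideal tetrahedron is determined by its edge lengths, as far as its dihedral angles are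
concerned. -/
theorem dihedral_eq_of_hasLengths {P Q : HyperidealTetrahedron} {l : Fin 4 → Fin 4 → ℝ}
    (hP : P.HasLengths l) (hQ : Q.HasLengths l) (i j : Fin 4) :
    P.dihedral i j = Q.dihedral i j := by
  have hG : ∀ a b, lorentz (P.v a) (P.v b) = lorentz (Q.v a) (Q.v b) := by
    intro a b
    by_cases hab : a = b
    · subst hab; rw [P.unit, Q.unit]
    · have h1 := P.cosh_length hab
      have h2 := Q.cosh_length hab
      rw [hP a b hab] at h1
      rw [hQ a b hab] at h2
      linarith
  have hN : ∀ k h, lorentz (P.normalPart i j k) (P.normalPart i j h) =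
      lorentz (Q.normalPart i j k) (Q.normalPart i j h) := by
    intro k h
    simp only [normalPart, lorentz_comb, hG]
  simp only [dihedral, hN]

end HyperidealTetrahedron

open Classical in
/-- The dihedral angle at the edge `{ij}` of the hyper-ideal tetrahedron with edge lengths `l`
(and `0` if there is no such tetrahedron). -/
noncomputable def dihedralOfLengths (l : Fin 4 → Fin 4 → ℝ) (i j : Fin 4) : ℝ :=
  if h : ∃ P : HyperidealTetrahedron, P.HasLengths l then h.choose.dihedral i j else 0

theorem dihedralOfLengths_eq {l : Fin 4 → Fin 4 → ℝ} {P : HyperidealTetrahedron}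
    (hP : P.HasLengths l) (i j : Fin 4) : dihedralOfLengths l i j = P.dihedral i j := by
  have h : ∃ P : HyperidealTetrahedron, P.HasLengths l := ⟨P, hP⟩
  rw [dihedralOfLengths, dif_pos h]
  exact HyperidealTetrahedron.dihedral_eq_of_hasLengths h.choose_spec hP i j

/-! ### Ideally triangulated compact 3-manifolds with boundary -/

/-- A gluing of tetrahedra (indexed by `T`) along all their faces. The vertices of every
tetrahedron are labelled by `Fin 4` and face `f` is the face opposite to vertex `f`. Face `f` of
`σ` is glued to face `perm σ f f` of `adj σ f` by the affine map sending vertex `a ≠ f` to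
vertex `perm σ f a`. Two different faces are glued each time, and gluings are mutually inverse. -/
structure FaceGluing (T : Type*) where
  adj : T → Fin 4 → T
  perm : T → Fin 4 → Equiv.Perm (Fin 4)
  adj_adj : ∀ σ f, adj (adj σ f) (perm σ f f) = σ
  perm_perm : ∀ σ f, perm (adj σ f) (perm σ f f) = (perm σ f)⁻¹
  face_ne : ∀ σ f, (adj σ f, perm σ f f) ≠ (σ, f)

namespace FaceGluing

variable {T : Type*} (𝒢 : FaceGluing T)

/-- Pairs of distinct vertices of a tetrahedron. -/
abbrev Pair (T : Type*) := {x : T × Fin 4 × Fin 4 // x.2.1 ≠ x.2.2}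

/-- Identification of tetrahedron vertices across the face `f`. -/
def VertexRel (x y : T × Fin 4) : Prop :=
  ∃ f, f ≠ x.2 ∧ y = (𝒢.adj x.1 f, 𝒢.perm x.1 f x.2)

/-- The set `V` of (hyper-ideal) vertices of the triangulation. -/
def Vertex : Type _ := Quot 𝒢.VertexRel

/-- Identification of oriented tetrahedron edges across the face `f`. -/
def EdgeRel (x y : Pair T) : Prop :=
  ∃ f, f ≠ x.1.2.1 ∧ f ≠ x.1.2.2 ∧
    y.1 = (𝒢.adj x.1.1 f, 𝒢.perm x.1.1 f x.1.2.1, 𝒢.perm x.1.1 f x.1.2.2)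

/-- Oriented edges of the triangulation; the class of `(σ, a, b)` is the edge from `a` to `b`.
These are also the vertices of the links of the vertices of the triangulation: an oriented edge
is a vertex of the link of its origin. -/
def OrientedEdge : Type _ := Quot 𝒢.EdgeRel

/-- Identification of the sides of the vertex triangles: `(σ, a, f)` is the vertex edge in which
the vertex triangle of `σ` at `a` meets face `f`. -/
def LinkSideRel (x y : Pair T) : Prop :=
  y.1 = (𝒢.adj x.1.1 x.1.2.2, 𝒢.perm x.1.1 x.1.2.2 x.1.2.1, 𝒢.perm x.1.1 x.1.2.2 x.1.2.2)

/-- The edges of the links of the vertices of the triangulation. -/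
def LinkEdge : Type _ := Quot 𝒢.LinkSideRel

/-- The vertex of the triangulation at corner `a` of the tetrahedron `σ`. -/
def vertex (σ : T) (a : Fin 4) : 𝒢.Vertex := Quot.mk _ (σ, a)

/-- The vertex at which an oriented edge starts. -/
def origin (e : 𝒢.OrientedEdge) : 𝒢.Vertex :=
  Quot.lift (fun x : Pair T => 𝒢.vertex x.1.1 x.1.2.1)
    (by
      rintro x y ⟨f, hf, -, hy⟩
      exact Quot.sound ⟨f, hf, by rw [hy]⟩) e

/-- The vertex to whose link a link edge belongs. -/
def linkEdgeVertex (e : 𝒢.LinkEdge) : 𝒢.Vertex :=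
  Quot.lift (fun x : Pair T => 𝒢.vertex x.1.1 x.1.2.1)
    (by
      rintro x y hy
      exact Quot.sound ⟨x.1.2.2, x.2.symm, by rw [hy]⟩) e

end FaceGluing

/-- An ideally triangulated compact 3-manifold with boundary: a gluing of finitely many tetrahedra
along their faces in which no edge is identified with itself with reversed orientation. This is
exactly the condition for the glued space minus its vertices to be a 3-manifold; removing open
stars of the vertices from the glued space one obtains the compact manifold `Σ`. The boundary
components `Σ_i` of `Σ` are the links of the vertices `i`, closed surfaces triangulated by
the vertex triangles. -/
structure IdealTriangulation (T : Type*) extends FaceGluing T where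
  not_reversed : ∀ (σ : T) (a b : Fin 4) (h : a ≠ b),
    (Quot.mk _ ⟨(σ, a, b), h⟩ : toFaceGluing.OrientedEdge) ≠ Quot.mk _ ⟨(σ, b, a), h.symm⟩

namespace IdealTriangulation

variable {T : Type*} [Fintype T] (𝒯 : IdealTriangulation T)

noncomputable instance : Fintype 𝒯.OrientedEdge :=
  letI : Finite 𝒯.OrientedEdge := inferInstanceAs (Finite (Quot _))
  Fintype.ofFinite _

/-- The degree `d_i` of a vertex: the number of vertex triangles of `Σ_i`, i.e. of corners of
tetrahedra at `i`. -/
noncomputable def degree (i : 𝒯.Vertex) : ℕ :=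
  Nat.card {x : T × Fin 4 // 𝒯.vertex x.1 x.2 = i}

/-- The Euler characteristic `χ(Σ_i)` of the boundary component at `i`, from its triangulation
by the vertex triangles: vertices minus edges plus triangles. -/
noncomputable def eulerChar (i : 𝒯.Vertex) : ℤ :=
  (Nat.card {e : 𝒯.OrientedEdge // 𝒯.origin e = i} : ℤ)
    - Nat.card {e : 𝒯.LinkEdge // 𝒯.linkEdgeVertex e = i}
    + Nat.card {x : T × Fin 4 // 𝒯.vertex x.1 x.2 = i}

/-- The edge lengths `l_{ab} = r_a + r_b` of the tetrahedron `σ`. -/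
def edgeLength (r : 𝒯.Vertex → ℝ) (σ : T) (a b : Fin 4) : ℝ :=
  r (𝒯.vertex σ a) + r (𝒯.vertex σ b)

/-- Generalized sphere packing metrics: positive functions on the vertices such that the edge
lengths `r_i + r_j` are those of non-degenerate hyper-ideal tetrahedra. -/
def IsSpherePackingMetric (r : 𝒯.Vertex → ℝ) : Prop :=
  (∀ i, 0 < r i) ∧ ∀ σ, ∃ P : HyperidealTetrahedron, P.HasLengths (𝒯.edgeLength r σ)

open Classical in
/-- The combinatorial Ricci curvature of an edge: `2π` minus the sum of the dihedral angles
around the edge. -/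
noncomputable def ricciCurvature (r : 𝒯.Vertex → ℝ) (e : 𝒯.OrientedEdge) : ℝ :=
  2 * π - ∑ x : FaceGluing.Pair T with (Quot.mk _ x : 𝒯.OrientedEdge) = e,
    dihedralOfLengths (𝒯.edgeLength r x.1.1) x.1.2.1 x.1.2.2

open Classical in
/-- The combinatorial scalar curvature `K_i`: the sum of the combinatorial Ricci curvatures of the
edges at `i` (an edge with both ends at `i` is counted once for each end). -/
noncomputable def scalarCurvature (r : 𝒯.Vertex → ℝ) (i : 𝒯.Vertex) : ℝ :=
  ∑ e : 𝒯.OrientedEdge with 𝒯.origin e = i, 𝒯.ricciCurvature r e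

/-- `r` is a solution on the time interval `I` (which starts at `0`) of the combinatorial Ricci flow
`dr_i/dt = K_i - Kbar_i`, `r(0) = r₀`, through generalized sphere packing metrics. -/
def IsRicciFlow (Kbar r₀ : 𝒯.Vertex → ℝ) (I : Set ℝ) (r : ℝ → 𝒯.Vertex → ℝ) : Prop :=
  r 0 = r₀ ∧ ∀ t ∈ I, 𝒯.IsSpherePackingMetric (r t) ∧
    ∀ i, HasDerivWithinAt (fun s => r s i) (𝒯.scalarCurvature (r t) i - Kbar i) I t

/-- `M` is an upper bound for the solution of the combinatorial Ricci flow starting at `r₀`, on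
every interval `[0, τ)` on which it exists. -/
def IsFlowBound (Kbar r₀ : 𝒯.Vertex → ℝ) (M : ℝ) : Prop :=
  ∀ (τ : ℝ) (r : ℝ → 𝒯.Vertex → ℝ), 𝒯.IsRicciFlow Kbar r₀ (Set.Ico 0 τ) r →
    ∀ t ∈ Set.Ico 0 τ, ∀ i, r t i ≤ M

end IdealTriangulation

/-! ### The constants -/

/-- `C₁(χ, d, M) = 2πχ + d (π - 3 arccos ((1 + tanh² M) / (1 + 3 tanh² M)))`. -/
noncomputable def constC₁ (χ : ℤ) (d : ℕ) (M : ℝ) : ℝ :=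
  2 * π * χ + d * (π - 3 * arccos ((1 + tanh M ^ 2) / (1 + 3 * tanh M ^ 2)))

/-- `C₂(χ, d, M, c) = 2πχ + d (π - 3 arccos (1/2 + (1 - tanh² c) /
(2 (1 + tanh² M + 2 tanh c tanh M))))`. -/
noncomputable def constC₂ (χ : ℤ) (d : ℕ) (M c : ℝ) : ℝ :=
  2 * π * χ + d * (π - 3 * arccos
    (1 / 2 + (1 - tanh c ^ 2) / (2 * (1 + tanh M ^ 2 + 2 * tanh c * tanh M))))

/-!
Write `t i = tanh (r i)`. The Gram matrix of a hyper-ideal tetrahedron with edge lengths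
`r i + r j` has entries `cosh (r i) cosh (r j) (2 δ_ij - 1 - t i t j)`, a perturbation of rank two
of a diagonal matrix. Its determinant is a negative multiple of `gramDiscr`, which is positive for
`t i ∈ (0, 1)`, so that every positive `r` is a generalized sphere packing metric
(`exists_hasLengths`), and the dihedral angles are explicit functions `edgeAngle` of the `t i`
(`dihedral_eq_edgeAngle`).

All the rest follows from the derivative of the sum `angleSum` of the three dihedral angles at a
corner (`hasDerivAt_angleSum`). The matrix `∂(angle sum at i) / ∂(r j)` is, up to the factor
`1 / √gramDiscr`, symmetric with positive entries `(1 - t i ^ 2) (1 - t j ^ 2) q_ij` off the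
diagonal, and it is diagonally dominant after rescaling by `1 - t i ^ 2`, the excess being governed
by `vertexExcess`. There are two consequences:

* the angle sum at a corner increases with each of the four radii (`angleSum_mono`);
* the map from the radii to the four angle sums is strongly monotone on compact sets of positive
  radii (`cornerAngleSum_strongly_monotone`).

Counting simplices of the link turns the scalar curvature into `2 π χ` plus the sum over the corners
at the vertex of `π` minus the angle sum (`scalarCurvature_eq`). Hence the curvature map is strongly
antitone on compact sets (`scalarCurvature_strongly_antitone`), so that the Euclidean distance of
two solutions of the flow never increases, and decays exponentially as long as both stay in a
compact set of positive radii (`IsRicciFlow.sum_sq_sub_le`). Since `rbar` is a constant solution,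
this gives uniqueness, the upper bound and the rate of convergence.

What is left for long time existence is a lower bound. If all radii are at most `M` and `r i ≤ c`,
the first consequence bounds each angle sum at `i` by the one with radii `c, M, M, M`, so the
curvature at `i` is at least `constC₂` (`constC₂_le_scalarCurvature`), hence at least `Kbar i`, and
`r i` does not decrease. The solution of the equation whose vector field is clamped to a box exists
for all time, and the two bounds show that it never leaves the box.
-/

/-! ### Hyperbolic functions -/

theorem Real.hasDerivAt_tanh (x : ℝ) : HasDerivAt tanh (1 - tanh x ^ 2) x := by
  have h := (Real.hasDerivAt_sinh x).div (Real.hasDerivAt_cosh x) (Real.cosh_pos x).ne'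
  have e : tanh = fun x => sinh x / cosh x := funext Real.tanh_eq_sinh_div_cosh
  rw [e]
  convert! h using 1
  have := (Real.cosh_pos x).ne'
  field_simp

theorem Real.tanh_mem_Ioo {x : ℝ} (hx : 0 < x) : tanh x ∈ Set.Ioo (0 : ℝ) 1 := by
  refine ⟨?_, Real.tanh_lt_one x⟩
  rw [Real.tanh_eq_sinh_div_cosh]
  exact div_pos (Real.sinh_pos_iff.2 hx) (Real.cosh_pos x)

theorem Real.tanh_monotone : Monotone tanh := by
  refine monotone_of_deriv_nonneg (fun x => (Real.hasDerivAt_tanh x).differentiableAt) fun x => ?_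
  rw [(Real.hasDerivAt_tanh x).deriv]
  linarith [Real.tanh_sq_lt_one x]

theorem Real.tanh_strictMono : StrictMono tanh :=
  Real.tanh_monotone.strictMono_of_injective Real.tanh_injective

theorem Real.contDiff_tanh {n : WithTop ℕ∞} : ContDiff ℝ n tanh := by
  have e : tanh = fun x => sinh x / cosh x := funext Real.tanh_eq_sinh_div_cosh
  rw [e]
  exact Real.contDiff_sinh.div Real.contDiff_cosh fun x => (Real.cosh_pos x).ne'

theorem Real.cosh_sq_mul_one_sub_tanh_sq (x : ℝ) : cosh x ^ 2 * (1 - tanh x ^ 2) = 1 := by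
  rw [Real.tanh_eq_sinh_div_cosh]
  have := (Real.cosh_pos x).ne'
  field_simp
  exact Real.cosh_sq_sub_sinh_sq x

theorem Real.cosh_add_eq_tanh (x y : ℝ) :
    cosh (x + y) = cosh x * cosh y * (1 + tanh x * tanh y) := by
  rw [Real.cosh_add, Real.tanh_eq_sinh_div_cosh, Real.tanh_eq_sinh_div_cosh]
  have := (Real.cosh_pos x).ne'
  have := (Real.cosh_pos y).ne'
  field_simp

/-! ### The dihedral angles as functions of the radii -/

/-- For a face with vertex parameters `a, b, x`, this is `-1/4` times the Gram determinant of
its three vertices, divided by the squares of the hyperbolic cosines of the radii. -/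
def facePoly (a b x : ℝ) : ℝ := 1 + a * b + a * x + b * x

/-- The numerator of the cosine of the dihedral angle at the edge with vertex parameters
`a, b`, the other two vertices having parameters `x, y`. -/
def cosNumer (a b x y : ℝ) : ℝ := 2 - a ^ 2 - b ^ 2 + (a + b) * (x + y)

/-- The Gram determinant of a tetrahedron with vertex parameters `a, b, x, y`, divided by
the squares of the hyperbolic cosines of the radii and by `-4`. -/
def gramDiscr (a b x y : ℝ) : ℝ :=
  4 + (a + b + x + y) ^ 2 - 2 * (a ^ 2 + b ^ 2 + x ^ 2 + y ^ 2)

/-- The dihedral angle at the edge between the vertices with parameters `a` and `b`, in the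
tetrahedron whose other two vertices have parameters `x` and `y`. The parameter of a vertex is the
hyperbolic tangent of its radius. -/
noncomputable def edgeAngle (a b x y : ℝ) : ℝ :=
  arccos (cosNumer a b x y / (2 * √(facePoly a b x * facePoly a b y)))

/-- The sum of the dihedral angles at the three edges from the vertex with parameter `a` to
those with parameters `b`, `x`, `y`. -/
noncomputable def angleSum (a b x y : ℝ) : ℝ :=
  edgeAngle a b x y + edgeAngle a x b y + edgeAngle a y b x

theorem facePoly_pos {a b x : ℝ} (ha : 0 < a) (hb : 0 < b) (hx : 0 < x) :
    0 < facePoly a b x := by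
  unfold facePoly; positivity

theorem gramDiscr_pos {a b x y : ℝ} (ha : a ∈ Set.Ioo (0 : ℝ) 1) (hb : b ∈ Set.Ioo (0 : ℝ) 1)
    (hx : x ∈ Set.Ioo (0 : ℝ) 1) (hy : y ∈ Set.Ioo (0 : ℝ) 1) : 0 < gramDiscr a b x y := by
  obtain ⟨ha, ha'⟩ := ha
  obtain ⟨hb, hb'⟩ := hb
  obtain ⟨hx, hx'⟩ := hx
  obtain ⟨hy, hy'⟩ := hy
  have e : gramDiscr a b x y = (1 - a ^ 2) + (1 - b ^ 2) + (1 - x ^ 2) + (1 - y ^ 2)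
      + 2 * (a * b + a * x + a * y + b * x + b * y + x * y) := by
    unfold gramDiscr; ring
  have h : ∀ s : ℝ, 0 < s → s < 1 → 0 < 1 - s ^ 2 := fun s h0 h1 => by nlinarith
  have := h a ha ha'
  have := h b hb hb'
  have := h x hx hx'
  have := h y hy hy'
  rw [e]; positivity

/-- Sylvester's determinant identity for the Gram matrix; it shows that
the cosine of the dihedral angle lies strictly between `-1` and `1`. -/
theorem four_mul_facePoly_mul_sub (a b x y : ℝ) :
    4 * (facePoly a b x * facePoly a b y) - cosNumer a b x y ^ 2
      = (a + b) ^ 2 * gramDiscr a b x y := by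
  unfold facePoly cosNumer gramDiscr; ring

theorem hasDerivAt_edgeAngle {a b x y : ℝ → ℝ} {a' b' x' y' s : ℝ}
    (ha : HasDerivAt a a' s) (hb : HasDerivAt b b' s)
    (hx : HasDerivAt x x' s) (hy : HasDerivAt y y' s)
    (ha0 : a s ∈ Set.Ioo (0 : ℝ) 1) (hb0 : b s ∈ Set.Ioo (0 : ℝ) 1)
    (hx0 : x s ∈ Set.Ioo (0 : ℝ) 1) (hy0 : y s ∈ Set.Ioo (0 : ℝ) 1) :
    HasDerivAt (fun s => edgeAngle (a s) (b s) (x s) (y s))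
      ((a' * (2 - ((a s + b s + x s - y s) * (b s + x s) / facePoly (a s) (b s) (x s)
            + (a s + b s + y s - x s) * (b s + y s) / facePoly (a s) (b s) (y s)) / 2)
        + b' * (2 - ((a s + b s + x s - y s) * (a s + x s) / facePoly (a s) (b s) (x s)
            + (a s + b s + y s - x s) * (a s + y s) / facePoly (a s) (b s) (y s)) / 2)
        - x' * ((a s + b s) * (a s + b s + x s - y s) / (2 * facePoly (a s) (b s) (x s)))
        - y' * ((a s + b s) * (a s + b s + y s - x s) / (2 * facePoly (a s) (b s) (y s))))
        / √(gramDiscr (a s) (b s) (x s) (y s))) s := by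
  have hD := gramDiscr_pos ha0 hb0 hx0 hy0
  have hP := facePoly_pos ha0.1 hb0.1 hx0.1
  have hQ := facePoly_pos ha0.1 hb0.1 hy0.1
  have hab : 0 < a s + b s := add_pos ha0.1 hb0.1
  have key := four_mul_facePoly_mul_sub (a s) (b s) (x s) (y s)
  have hN : HasDerivAt (fun s => cosNumer (a s) (b s) (x s) (y s))
      (a' * (x s + y s - 2 * a s) + b' * (x s + y s - 2 * b s) + (a s + b s) * (x' + y')) s := by
    unfold cosNumer
    convert! (((hasDerivAt_const s (2 : ℝ)).sub (ha.pow 2)).sub (hb.pow 2)).add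
      ((ha.add hb).mul (hx.add hy)) using 1
    simp; ring
  have hP' : HasDerivAt (fun s => facePoly (a s) (b s) (x s))
      (a' * (b s + x s) + b' * (a s + x s) + x' * (a s + b s)) s := by
    unfold facePoly
    convert! (((hasDerivAt_const s (1 : ℝ)).add (ha.mul hb)).add (ha.mul hx)).add
      (hb.mul hx) using 1
    ring
  have hQ' : HasDerivAt (fun s => facePoly (a s) (b s) (y s))
      (a' * (b s + y s) + b' * (a s + y s) + y' * (a s + b s)) s := by
    unfold facePoly
    convert! (((hasDerivAt_const s (1 : ℝ)).add (ha.mul hb)).add (ha.mul hy)).add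
      (hb.mul hy) using 1
    ring
  have hPQ := mul_pos hP hQ
  have hR := (hP'.mul hQ').sqrt hPQ.ne'
  simp only [Pi.mul_apply] at hR
  have hr0 : 0 < √(facePoly (a s) (b s) (x s) * facePoly (a s) (b s) (y s)) := Real.sqrt_pos.2 hPQ
  have hd0 : 0 < √(gramDiscr (a s) (b s) (x s) (y s)) := Real.sqrt_pos.2 hD
  have hr2 := Real.sq_sqrt hPQ.le
  have hd2 := Real.sq_sqrt hD.le
  have hF := hN.div (hR.const_mul 2) (by positivity)
  set r := √(facePoly (a s) (b s) (x s) * facePoly (a s) (b s) (y s)) with hr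
  set d := √(gramDiscr (a s) (b s) (x s) (y s)) with hd
  have hsq : 1 - (cosNumer (a s) (b s) (x s) (y s) / (2 * r)) ^ 2
      = ((a s + b s) * d / (2 * r)) ^ 2 := by
    rw [div_pow, div_pow, mul_pow (a s + b s), hd2, ← key, ← hr2]
    field_simp
    ring
  have hpos : 0 < (a s + b s) * d / (2 * r) := by positivity
  have hne : 0 < 1 - (cosNumer (a s) (b s) (x s) (y s) / (2 * r)) ^ 2 := by
    rw [hsq]; positivity
  have hA := (Real.hasDerivAt_arccos (x := cosNumer (a s) (b s) (x s) (y s) / (2 * r))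
    (by intro h; rw [h] at hne; norm_num at hne)
    (by intro h; rw [h] at hne; norm_num at hne)).comp s hF
  rw [hsq, Real.sqrt_sq hpos.le] at hA
  convert! hA using 1
  have hder : ∀ N' P' Q' : ℝ, -(1 / ((a s + b s) * d / (2 * r))) *
      ((N' * (2 * r) - cosNumer (a s) (b s) (x s) (y s) * (2 * ((P' * facePoly (a s) (b s) (y s)
        + facePoly (a s) (b s) (x s) * Q') / (2 * r)))) / (2 * r) ^ 2)
      = (cosNumer (a s) (b s) (x s) (y s) * (P' / facePoly (a s) (b s) (x s)
        + Q' / facePoly (a s) (b s) (y s)) / 2 - N') / ((a s + b s) * d) := by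
    intro N' P' Q'
    have e : ∀ n X : ℝ, -(1 / ((a s + b s) * d / (2 * r))) *
        ((N' * (2 * r) - n * (2 * (X / (2 * r)))) / (2 * r) ^ 2)
        = (n * X / r ^ 2 / 2 - N') / ((a s + b s) * d) := by
      intro n X; field_simp; ring
    rw [e, hr2]
    field_simp
  rw [hder, eq_div_iff (by positivity), div_mul_eq_mul_div, div_eq_iff hd0.ne']
  have hPi := mul_inv_cancel₀ hP.ne'
  have hQi := mul_inv_cancel₀ hQ.ne'
  simp only [div_eq_mul_inv, mul_inv]
  generalize (facePoly (a s) (b s) (x s))⁻¹ = p at *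
  generalize (facePoly (a s) (b s) (y s))⁻¹ = q at *
  -- With these, `a s + b s` cancels from the derivative of the cosine.
  have hN1 : cosNumer (a s) (b s) (x s) (y s) * p
      = 2 - (a s + b s) * (a s + b s + x s - y s) * p := by
    rw [show cosNumer (a s) (b s) (x s) (y s) = 2 * facePoly (a s) (b s) (x s)
      - (a s + b s) * (a s + b s + x s - y s) by unfold cosNumer facePoly; ring]
    linear_combination 2 * hPi
  have hN2 : cosNumer (a s) (b s) (x s) (y s) * q
      = 2 - (a s + b s) * (a s + b s + y s - x s) * q := by
    rw [show cosNumer (a s) (b s) (x s) (y s) = 2 * facePoly (a s) (b s) (y s)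
      - (a s + b s) * (a s + b s + y s - x s) by unfold cosNumer facePoly; ring]
    linear_combination 2 * hQi
  linear_combination -(d / 2) * (a' * (b s + x s) + b' * (a s + x s) + x' * (a s + b s)) * hN1
    - (d / 2) * (a' * (b s + y s) + b' * (a s + y s) + y' * (a s + b s)) * hN2

/-- Up to the factor `(1 - a ^ 2) (1 - b ^ 2) / √(gramDiscr a b x y)`, the derivative of the
angle sum at the vertex with parameter `a` with respect to the radius at the vertex with
parameter `b`. It is symmetric in `a` and `b`. -/
noncomputable def pairCoeff (a b x y : ℝ) : ℝ :=
  (facePoly a b x + facePoly a b y - (x - y) ^ 2) / (facePoly a b x * facePoly a b y)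

/-- This times `2 a` is the amount by which the diagonal entry of the Jacobian of the
angle sums, in the row of the vertex with parameter `a`, exceeds the sum of the other entries after
rescaling. -/
noncomputable def vertexExcess (a b x y : ℝ) : ℝ :=
  (a + b + x - y) / facePoly a b x + (a + b + y - x) / facePoly a b y
    + (a + x + y - b) / facePoly a x y

theorem pairCoeff_pos {a b x y : ℝ} (ha : 0 < a) (hb : 0 < b) (hx : x ∈ Set.Ioo (0 : ℝ) 1)
    (hy : y ∈ Set.Ioo (0 : ℝ) 1) : 0 < pairCoeff a b x y := by
  obtain ⟨hx, hx'⟩ := hx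
  obtain ⟨hy, hy'⟩ := hy
  have hP := facePoly_pos ha hb hx
  have hQ := facePoly_pos ha hb hy
  refine div_pos ?_ (mul_pos hP hQ)
  have : (x - y) ^ 2 < 1 := by nlinarith
  have : 1 < facePoly a b x := by
    unfold facePoly
    nlinarith [mul_pos ha hb, mul_pos ha hx, mul_pos hb hx]
  linarith

/-- Only the first term of `vertexExcess` can be negative here. In that case
`a + b + x < y`, and the two other terms, which have the common upper bound
`1 + (a + b + x) ^ 2 / 4 + (a + b + x) * y` for their denominators, outweigh it. -/
theorem le_vertexExcess_of_le {a b x y : ℝ} (ha : a ∈ Set.Ioo (0 : ℝ) 1)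
    (hb : b ∈ Set.Ioo (0 : ℝ) 1) (hx : x ∈ Set.Ioo (0 : ℝ) 1) (hy : y ∈ Set.Ioo (0 : ℝ) 1)
    (hby : b ≤ y) (hxy : x ≤ y) : a / 4 ≤ vertexExcess a b x y := by
  obtain ⟨ha, ha'⟩ := ha
  obtain ⟨hb, hb'⟩ := hb
  obtain ⟨hx, hx'⟩ := hx
  obtain ⟨hy, hy'⟩ := hy
  have hlow : ∀ {u n p : ℝ}, 0 ≤ n → 0 < p → p ≤ u → n / u ≤ n / p := by
    intro u n p hn hp h; gcongr
  have h4 : ∀ {u v w : ℝ}, 0 < u → 0 < v → 0 < w → u < 1 → v < 1 → w < 1 →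
      facePoly u v w ≤ 4 := by
    intro u v w hu hv hw hu' hv' hw'; unfold facePoly; nlinarith
  have hP := facePoly_pos ha hb hx
  have hQ := facePoly_pos ha hb hy
  have hR := facePoly_pos ha hx hy
  unfold vertexExcess
  rcases le_or_gt y (a + b + x) with h | h
  · have h1 := hlow (n := a + b + x - y) (by linarith) hP (h4 ha hb hx ha' hb' hx')
    have h2 := hlow (n := a + b + y - x) (by linarith) hQ (h4 ha hb hy ha' hb' hy')
    have h3 := hlow (n := a + x + y - b) (by linarith) hR (h4 ha hx hy ha' hx' hy')
    linarith
  · have h1 : -(y - (a + b + x)) ≤ (a + b + x - y) / facePoly a b x := by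
      rw [le_div_iff₀ hP]
      unfold facePoly
      nlinarith [mul_pos ha hb, mul_pos ha hx, mul_pos hb hx]
    set u := 1 + (a + b + x) ^ 2 / 4 + (a + b + x) * y with hu
    have hu0 : 0 < u := by positivity
    have h2 := hlow (u := u) (n := a + b + y - x) (by linarith) hQ
      (by
        rw [hu]; unfold facePoly
        nlinarith [sq_nonneg (a - b), mul_pos ha hx, mul_pos hb hx, mul_pos hx hy])
    have h3 := hlow (u := u) (n := a + x + y - b) (by linarith) hR
      (by
        rw [hu]; unfold facePoly
        nlinarith [sq_nonneg (a - x), mul_pos ha hb, mul_pos hb hx, mul_pos hb hy])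
    have h4 : y - (a + b + x) + a / 4 ≤ (2 * a + 2 * y) / u := by
      rw [le_div_iff₀ hu0, hu]
      have hs : 0 < a + b + x := by positivity
      generalize hsg : a + b + x = s at *
      have has : a ≤ s := by linarith
      nlinarith [mul_pos hs hy, mul_pos (mul_pos hs hs) hy, mul_pos (mul_pos hs hs) hs,
        mul_pos ha hy, mul_nonneg (mul_pos hs hy).le (sub_nonneg.2 hy'.le), mul_pos ha hs,
        mul_pos (mul_pos ha hs) hs, mul_pos (mul_pos ha hs) hy]
    have e : (a + b + y - x) / u + (a + x + y - b) / u = (2 * a + 2 * y) / u := by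
      rw [← add_div]; ring
    linarith

theorem vertexExcess_swap_left (a b x y : ℝ) : vertexExcess a b x y = vertexExcess a x b y := by
  unfold vertexExcess facePoly; ring_nf

theorem vertexExcess_swap_right (a b x y : ℝ) : vertexExcess a b x y = vertexExcess a b y x := by
  unfold vertexExcess facePoly; ring_nf

theorem le_vertexExcess {a b x y : ℝ} (ha : a ∈ Set.Ioo (0 : ℝ) 1)
    (hb : b ∈ Set.Ioo (0 : ℝ) 1) (hx : x ∈ Set.Ioo (0 : ℝ) 1) (hy : y ∈ Set.Ioo (0 : ℝ) 1) :
    a / 4 ≤ vertexExcess a b x y := by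
  rcases le_total b y with h1 | h1
  · rcases le_total x y with h2 | h2
    · exact le_vertexExcess_of_le ha hb hx hy h1 h2
    · rw [vertexExcess_swap_right]
      exact le_vertexExcess_of_le ha hb hy hx (h1.trans h2) h2
  · rcases le_total x b with h2 | h2
    · rw [vertexExcess_swap_right, vertexExcess_swap_left, vertexExcess_swap_right]
      rw [vertexExcess_swap_left]
      exact le_vertexExcess_of_le ha hx hy hb h2 h1
    · rw [vertexExcess_swap_right]
      exact le_vertexExcess_of_le ha hb hy hx h2 (h1.trans h2)

/-- The form in which the off-diagonal entries of the Jacobian arise. The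
factor `1 - a ^ 2` on the left comes from `(a + b) * (a + x) = facePoly a b x - (1 - a ^ 2)`. -/
theorem one_sub_sq_mul_pairCoeff {a b x y : ℝ} (ha : 0 < a) (hb : 0 < b) (hx : 0 < x)
    (hy : 0 < y) : (1 - a ^ 2) * pairCoeff a b x y
      = 2 - (a + x) * (a + b + x - y) / facePoly a b x
        - (a + y) * (a + b + y - x) / facePoly a b y := by
  have hP := (facePoly_pos ha hb hx).ne'
  have hQ := (facePoly_pos ha hb hy).ne'
  unfold pairCoeff
  field_simp
  unfold facePoly
  ring

theorem hasDerivAt_angleSum {a b x y : ℝ → ℝ} {a' b' x' y' s : ℝ}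
    (ha : HasDerivAt a a' s) (hb : HasDerivAt b b' s)
    (hx : HasDerivAt x x' s) (hy : HasDerivAt y y' s)
    (ha0 : a s ∈ Set.Ioo (0 : ℝ) 1) (hb0 : b s ∈ Set.Ioo (0 : ℝ) 1)
    (hx0 : x s ∈ Set.Ioo (0 : ℝ) 1) (hy0 : y s ∈ Set.Ioo (0 : ℝ) 1) :
    HasDerivAt (fun s => angleSum (a s) (b s) (x s) (y s))
      (((1 - a s ^ 2) * (pairCoeff (a s) (b s) (x s) (y s) * (a' + b')
          + pairCoeff (a s) (x s) (b s) (y s) * (a' + x')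
          + pairCoeff (a s) (y s) (b s) (x s) * (a' + y'))
        + 2 * a s * vertexExcess (a s) (b s) (x s) (y s) * a')
        / √(gramDiscr (a s) (b s) (x s) (y s))) s := by
  have h := ((hasDerivAt_edgeAngle ha hb hx hy ha0 hb0 hx0 hy0).add
    (hasDerivAt_edgeAngle ha hx hb hy ha0 hx0 hb0 hy0)).add
    (hasDerivAt_edgeAngle ha hy hb hx ha0 hy0 hb0 hx0)
  rw [show gramDiscr (a s) (x s) (b s) (y s) = gramDiscr (a s) (b s) (x s) (y s) by
      unfold gramDiscr; ring,
    show gramDiscr (a s) (y s) (b s) (x s) = gramDiscr (a s) (b s) (x s) (y s) by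
      unfold gramDiscr; ring, ← add_div, ← add_div] at h
  unfold angleSum
  convert! h using 2
  have c1 : ∀ u v w, facePoly u v w = facePoly u w v := by intros; unfold facePoly; ring
  rw [c1 (a s) (x s) (b s), c1 (a s) (y s) (b s), c1 (a s) (y s) (x s)]
  rw [mul_add, mul_add, ← mul_assoc, ← mul_assoc, ← mul_assoc,
    one_sub_sq_mul_pairCoeff ha0.1 hb0.1 hx0.1 hy0.1,
    one_sub_sq_mul_pairCoeff ha0.1 hx0.1 hb0.1 hy0.1,
    one_sub_sq_mul_pairCoeff ha0.1 hy0.1 hb0.1 hx0.1]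
  unfold vertexExcess
  rw [c1 (a s) (x s) (b s), c1 (a s) (y s) (b s), c1 (a s) (y s) (x s)]
  ring

/-! ### Monotonicity of the corner angle sums -/

theorem angleSum_mono {a b x y a' b' x' y' : ℝ} (ha : 0 < a) (hb : 0 < b) (hx : 0 < x) (hy : 0 < y)
    (haa : a ≤ a') (hbb : b ≤ b') (hxx : x ≤ x') (hyy : y ≤ y')
    (ha' : a' < 1) (hb' : b' < 1) (hx' : x' < 1) (hy' : y' < 1) :
    angleSum a b x y ≤ angleSum a' b' x' y' := by
  have hpath : ∀ u u' s : ℝ, HasDerivAt (fun s => u + s * (u' - u)) (u' - u) s := fun u u' s => by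
    simpa using ((hasDerivAt_id s).mul_const (u' - u)).const_add u
  have hmem : ∀ {u u' : ℝ}, 0 < u → u ≤ u' → u' < 1 → ∀ s ∈ Set.Icc (0 : ℝ) 1,
      u + s * (u' - u) ∈ Set.Ioo (0 : ℝ) 1 := by
    intro u u' h0 h h1 s hs
    constructor <;> nlinarith [mul_nonneg hs.1 (sub_nonneg.2 h),
      mul_nonneg (sub_nonneg.2 hs.2) (sub_nonneg.2 h)]
  have hd := fun (s : ℝ) (hs : s ∈ Set.Icc (0 : ℝ) 1) =>
    hasDerivAt_angleSum (hpath a a' s) (hpath b b' s) (hpath x x' s) (hpath y y' s)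
      (hmem ha haa ha' s hs) (hmem hb hbb hb' s hs) (hmem hx hxx hx' s hs) (hmem hy hyy hy' s hs)
  obtain ⟨s, hs, he⟩ := exists_hasDerivAt_eq_slope _ _ zero_lt_one
    (fun s hs => (hd s hs).continuousAt.continuousWithinAt)
    (fun s hs => hd s (Set.Ioo_subset_Icc_self hs))
  have hs' := Set.Ioo_subset_Icc_self hs
  have ma := hmem ha haa ha' s hs'
  have mb := hmem hb hbb hb' s hs'
  have mx := hmem hx hxx hx' s hs'
  have my := hmem hy hyy hy' s hs'
  simp only [sub_zero, div_one, one_mul, zero_mul, add_zero, add_sub_cancel] at he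
  rw [← sub_nonneg, ← he]
  have q1 := (pairCoeff_pos ma.1 mb.1 mx my).le
  have q2 := (pairCoeff_pos ma.1 mx.1 mb my).le
  have q3 := (pairCoeff_pos ma.1 my.1 mb mx).le
  have hE : 0 ≤ vertexExcess _ _ _ _ := le_trans (by linarith [ma.1]) (le_vertexExcess ma mb mx my)
  have h1 : 0 ≤ 1 - (a + s * (a' - a)) ^ 2 := by nlinarith [ma.1, ma.2]
  have da := sub_nonneg.2 haa
  have db := sub_nonneg.2 hbb
  have dx := sub_nonneg.2 hxx
  have dy := sub_nonneg.2 hyy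
  have ma0 := ma.1.le
  positivity

theorem pairCoeff_comm (a b x y : ℝ) : pairCoeff a b x y = pairCoeff b a x y := by
  unfold pairCoeff facePoly; ring_nf

/-- With `u, v, w, z` for the factors `1 - t ^ 2`, the quadratic form of the Jacobian is
the sum of the terms `p * (u * wa + v * wb) ^ 2` over the six edges and of the four diagonal
excesses. -/
theorem quadraticForm_ge {κ u v w z ea eb ex ey p1 p2 p3 p4 p5 p6 wa wb wx wy a b x y : ℝ}
    (hp1 : 0 ≤ p1) (hp2 : 0 ≤ p2) (hp3 : 0 ≤ p3) (hp4 : 0 ≤ p4) (hp5 : 0 ≤ p5) (hp6 : 0 ≤ p6)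
    (ta : κ / 2 * wa ^ 2 ≤ 2 * a * ea * u * wa ^ 2)
    (tb : κ / 2 * wb ^ 2 ≤ 2 * b * eb * v * wb ^ 2)
    (tx : κ / 2 * wx ^ 2 ≤ 2 * x * ex * w * wx ^ 2)
    (ty : κ / 2 * wy ^ 2 ≤ 2 * y * ey * z * wy ^ 2) :
    κ / 2 * (wa ^ 2 + wb ^ 2 + wx ^ 2 + wy ^ 2) ≤
      wa * (u * (p1 * (u * wa + v * wb) + p2 * (u * wa + w * wx) + p3 * (u * wa + z * wy))
        + 2 * a * ea * (u * wa))
      + wb * (v * (p1 * (v * wb + u * wa) + p4 * (v * wb + w * wx) + p5 * (v * wb + z * wy))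
        + 2 * b * eb * (v * wb))
      + wx * (w * (p2 * (w * wx + u * wa) + p4 * (w * wx + v * wb) + p6 * (w * wx + z * wy))
        + 2 * x * ex * (w * wx))
      + wy * (z * (p3 * (z * wy + u * wa) + p5 * (z * wy + v * wb) + p6 * (z * wy + w * wx))
        + 2 * y * ey * (z * wy)) := by
  have hsq : ∀ {q : ℝ} (z : ℝ), 0 ≤ q → 0 ≤ q * z ^ 2 := fun z hq => mul_nonneg hq (sq_nonneg z)
  have s1 := hsq (u * wa + v * wb) hp1
  have s2 := hsq (u * wa + w * wx) hp2
  have s3 := hsq (u * wa + z * wy) hp3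
  have s4 := hsq (v * wb + w * wx) hp4
  have s5 := hsq (v * wb + z * wy) hp5
  have s6 := hsq (w * wx + z * wy) hp6
  linear_combination ta + tb + tx + ty + s1 + s2 + s3 + s4 + s5 + s6

/-- Positive definiteness of the Jacobian of the angle sums with respect to the radii, the
sums being given as in `hasDerivAt_angleSum` for the derivatives `(1 - t ^ 2) * w` of the
parameters. -/
theorem angleForm_ge {a b x y wa wb wx wy κ : ℝ} (ha : a ∈ Set.Ioo (0 : ℝ) 1)
    (hb : b ∈ Set.Ioo (0 : ℝ) 1) (hx : x ∈ Set.Ioo (0 : ℝ) 1) (hy : y ∈ Set.Ioo (0 : ℝ) 1)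
    (ka : κ ≤ a ^ 2 * (1 - a ^ 2)) (kb : κ ≤ b ^ 2 * (1 - b ^ 2))
    (kx : κ ≤ x ^ 2 * (1 - x ^ 2)) (ky : κ ≤ y ^ 2 * (1 - y ^ 2)) (hκ : 0 ≤ κ) :
    κ / 10 * (wa ^ 2 + wb ^ 2 + wx ^ 2 + wy ^ 2) ≤
      wa * (((1 - a ^ 2) * (pairCoeff a b x y * ((1 - a ^ 2) * wa + (1 - b ^ 2) * wb)
          + pairCoeff a x b y * ((1 - a ^ 2) * wa + (1 - x ^ 2) * wx)
          + pairCoeff a y b x * ((1 - a ^ 2) * wa + (1 - y ^ 2) * wy))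
        + 2 * a * vertexExcess a b x y * ((1 - a ^ 2) * wa)) / √(gramDiscr a b x y))
      + wb * (((1 - b ^ 2) * (pairCoeff b a x y * ((1 - b ^ 2) * wb + (1 - a ^ 2) * wa)
          + pairCoeff b x a y * ((1 - b ^ 2) * wb + (1 - x ^ 2) * wx)
          + pairCoeff b y a x * ((1 - b ^ 2) * wb + (1 - y ^ 2) * wy))
        + 2 * b * vertexExcess b a x y * ((1 - b ^ 2) * wb)) / √(gramDiscr b a x y))
      + wx * (((1 - x ^ 2) * (pairCoeff x a b y * ((1 - x ^ 2) * wx + (1 - a ^ 2) * wa)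
          + pairCoeff x b a y * ((1 - x ^ 2) * wx + (1 - b ^ 2) * wb)
          + pairCoeff x y a b * ((1 - x ^ 2) * wx + (1 - y ^ 2) * wy))
        + 2 * x * vertexExcess x a b y * ((1 - x ^ 2) * wx)) / √(gramDiscr x a b y))
      + wy * (((1 - y ^ 2) * (pairCoeff y a b x * ((1 - y ^ 2) * wy + (1 - a ^ 2) * wa)
          + pairCoeff y b a x * ((1 - y ^ 2) * wy + (1 - b ^ 2) * wb)
          + pairCoeff y x a b * ((1 - y ^ 2) * wy + (1 - x ^ 2) * wx))
        + 2 * y * vertexExcess y a b x * ((1 - y ^ 2) * wy)) / √(gramDiscr y a b x)) := by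
  have hD := gramDiscr_pos ha hb hx hy
  have ea := le_vertexExcess ha hb hx hy
  have eb := le_vertexExcess hb ha hx hy
  have ex := le_vertexExcess hx ha hb hy
  have ey := le_vertexExcess hy ha hb hx
  have q1 := (pairCoeff_pos ha.1 hb.1 hx hy).le
  have q2 := (pairCoeff_pos ha.1 hx.1 hb hy).le
  have q3 := (pairCoeff_pos ha.1 hy.1 hb hx).le
  have q4 := (pairCoeff_pos hb.1 hx.1 ha hy).le
  have q5 := (pairCoeff_pos hb.1 hy.1 ha hx).le
  have q6 := (pairCoeff_pos hx.1 hy.1 ha hb).le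
  rw [show gramDiscr b a x y = gramDiscr a b x y by unfold gramDiscr; ring,
    show gramDiscr x a b y = gramDiscr a b x y by unfold gramDiscr; ring,
    show gramDiscr y a b x = gramDiscr a b x y by unfold gramDiscr; ring,
    pairCoeff_comm b a, pairCoeff_comm x a, pairCoeff_comm y a, pairCoeff_comm x b,
    pairCoeff_comm y b, pairCoeff_comm y x]
  have hd0 : 0 < √(gramDiscr a b x y) := Real.sqrt_pos.2 hD
  have hd5 : √(gramDiscr a b x y) ≤ 5 := by
    refine Real.sqrt_le_iff.2 ⟨by norm_num, ?_⟩
    have h4 : (a + b + x + y) ^ 2 ≤ 4 ^ 2 := by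
      have := ha.1; have := hb.1; have := hx.1; have := hy.1
      gcongr
      linarith [ha.2, hb.2, hx.2, hy.2]
    unfold gramDiscr
    linarith [sq_nonneg a, sq_nonneg b, sq_nonneg x, sq_nonneg y]
  have hterm : ∀ {t e : ℝ} (w : ℝ), t ∈ Set.Ioo (0 : ℝ) 1 → t / 4 ≤ e → κ ≤ t ^ 2 * (1 - t ^ 2) →
      κ / 2 * w ^ 2 ≤ 2 * t * e * (1 - t ^ 2) * w ^ 2 := by
    intro t e w ht he hk
    have h1 : 0 ≤ t * (1 - t ^ 2) := mul_nonneg ht.1.le (by nlinarith [ht.1, ht.2])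
    refine mul_le_mul_of_nonneg_right ?_ (sq_nonneg w)
    nlinarith [mul_le_mul_of_nonneg_left he h1]
  have t1 := hterm wa ha ea ka
  have t2 := hterm wb hb eb kb
  have t3 := hterm wx hx ex kx
  have t4 := hterm wy hy ey ky
  have hW : 0 ≤ wa ^ 2 + wb ^ 2 + wx ^ 2 + wy ^ 2 := by positivity
  calc κ / 10 * (wa ^ 2 + wb ^ 2 + wx ^ 2 + wy ^ 2)
      ≤ κ / 2 * (wa ^ 2 + wb ^ 2 + wx ^ 2 + wy ^ 2) / √(gramDiscr a b x y) := by
        rw [le_div_iff₀ hd0]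
        nlinarith [mul_le_mul_of_nonneg_left hd5 (mul_nonneg hκ hW)]
    _ ≤ _ := by
        simp only [mul_div_assoc', ← add_div]
        refine div_le_div_of_nonneg_right ?_ hd0.le
        exact quadraticForm_ge q1 q2 q3 q4 q5 q6 t1 t2 t3 t4

/-- The sum of the dihedral angles at the three edges meeting in the vertex `i` of the
tetrahedron with edge lengths `r i + r j`. -/
noncomputable def cornerAngleSum (r : Fin 4 → ℝ) (i : Fin 4) : ℝ :=
  ∑ j ∈ Finset.univ.erase i,
    edgeAngle (tanh (r i)) (tanh (r j)) (tanh (r (firstOther i j))) (tanh (r (lastOther i j)))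

theorem cornerAngleSum_zero (r : Fin 4 → ℝ) : cornerAngleSum r 0
    = angleSum (tanh (r 0)) (tanh (r 1)) (tanh (r 2)) (tanh (r 3)) := by
  rw [cornerAngleSum, show Finset.univ.erase (0 : Fin 4) = {1, 2, 3} by decide]
  simp [angleSum, firstOther, lastOther, add_assoc]

theorem cornerAngleSum_one (r : Fin 4 → ℝ) : cornerAngleSum r 1
    = angleSum (tanh (r 1)) (tanh (r 0)) (tanh (r 2)) (tanh (r 3)) := by
  rw [cornerAngleSum, show Finset.univ.erase (1 : Fin 4) = {0, 2, 3} by decide]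
  simp [angleSum, firstOther, lastOther, add_assoc]

theorem cornerAngleSum_two (r : Fin 4 → ℝ) : cornerAngleSum r 2
    = angleSum (tanh (r 2)) (tanh (r 0)) (tanh (r 1)) (tanh (r 3)) := by
  rw [cornerAngleSum, show Finset.univ.erase (2 : Fin 4) = {0, 1, 3} by decide]
  simp [angleSum, firstOther, lastOther, add_assoc]

theorem cornerAngleSum_three (r : Fin 4 → ℝ) : cornerAngleSum r 3
    = angleSum (tanh (r 3)) (tanh (r 0)) (tanh (r 1)) (tanh (r 2)) := by
  rw [cornerAngleSum, show Finset.univ.erase (3 : Fin 4) = {0, 1, 2} by decide]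
  simp [angleSum, firstOther, lastOther, add_assoc]

theorem cornerAngleSum_strongly_monotone {δ M : ℝ} (hδ : 0 < δ) : ∃ lam > 0, ∀ r r' : Fin 4 → ℝ,
    (∀ i, r i ∈ Set.Icc δ M) → (∀ i, r' i ∈ Set.Icc δ M) →
      lam * ∑ i, (r' i - r i) ^ 2 ≤
        ∑ i, (r' i - r i) * (cornerAngleSum r' i - cornerAngleSum r i) := by
  have hδt := Real.tanh_mem_Ioo hδ
  have hMt : 0 < 1 - tanh M ^ 2 := by linarith [Real.tanh_sq_lt_one M]
  refine ⟨tanh δ ^ 2 * (1 - tanh M ^ 2) / 10, by have := hδt.1; positivity, fun r r' hr hr' => ?_⟩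
  set κ := tanh δ ^ 2 * (1 - tanh M ^ 2) with hκ
  have hκ0 : 0 ≤ κ := by positivity
  have hpath : ∀ i s, HasDerivAt (fun s => tanh (r i + s * (r' i - r i)))
      ((1 - tanh (r i + s * (r' i - r i)) ^ 2) * (r' i - r i)) s := fun i s => by
    have h : HasDerivAt (fun s => r i + s * (r' i - r i)) (r' i - r i) s := by
      simpa using ((hasDerivAt_id s).mul_const (r' i - r i)).const_add (r i)
    exact (Real.hasDerivAt_tanh _).comp s h
  have hbox : ∀ i, ∀ s ∈ Set.Icc (0 : ℝ) 1, r i + s * (r' i - r i) ∈ Set.Icc δ M := by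
    intro i s hs
    have h := (convex_Icc δ M).add_smul_sub_mem (hr i) (hr' i) hs
    simpa using h
  have hmem : ∀ i, ∀ s ∈ Set.Icc (0 : ℝ) 1,
      tanh (r i + s * (r' i - r i)) ∈ Set.Ioo (0 : ℝ) 1 := fun i s hs =>
    Real.tanh_mem_Ioo (hδ.trans_le (hbox i s hs).1)
  have hκle : ∀ i, ∀ s ∈ Set.Icc (0 : ℝ) 1, κ ≤ tanh (r i + s * (r' i - r i)) ^ 2
      * (1 - tanh (r i + s * (r' i - r i)) ^ 2) := by
    intro i s hs
    have h1 := Real.tanh_monotone (hbox i s hs).1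
    have h2 := Real.tanh_monotone (hbox i s hs).2
    have h3 := (hmem i s hs).1
    have h4 := hδt.1
    rw [hκ]
    gcongr
  have hd := fun (s : ℝ) (hs : s ∈ Set.Icc (0 : ℝ) 1) =>
    ((((hasDerivAt_angleSum (hpath 0 s) (hpath 1 s) (hpath 2 s) (hpath 3 s)
      (hmem 0 s hs) (hmem 1 s hs) (hmem 2 s hs) (hmem 3 s hs)).const_mul (r' 0 - r 0)).add
    ((hasDerivAt_angleSum (hpath 1 s) (hpath 0 s) (hpath 2 s) (hpath 3 s)
      (hmem 1 s hs) (hmem 0 s hs) (hmem 2 s hs) (hmem 3 s hs)).const_mul (r' 1 - r 1))).add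
    ((hasDerivAt_angleSum (hpath 2 s) (hpath 0 s) (hpath 1 s) (hpath 3 s)
      (hmem 2 s hs) (hmem 0 s hs) (hmem 1 s hs) (hmem 3 s hs)).const_mul (r' 2 - r 2))).add
    ((hasDerivAt_angleSum (hpath 3 s) (hpath 0 s) (hpath 1 s) (hpath 2 s)
      (hmem 3 s hs) (hmem 0 s hs) (hmem 1 s hs) (hmem 2 s hs)).const_mul (r' 3 - r 3))
  -- Mean value theorem on the segment from `r` to `r'`.
  obtain ⟨s, hs, he⟩ := exists_hasDerivAt_eq_slope _ _ zero_lt_one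
    (fun s hs => (hd s hs).continuousAt.continuousWithinAt)
    (fun s hs => hd s (Set.Ioo_subset_Icc_self hs))
  have hs' := Set.Ioo_subset_Icc_self hs
  have hform := angleForm_ge (wa := r' 0 - r 0) (wb := r' 1 - r 1) (wx := r' 2 - r 2)
    (wy := r' 3 - r 3) (hmem 0 s hs') (hmem 1 s hs') (hmem 2 s hs') (hmem 3 s hs')
    (hκle 0 s hs') (hκle 1 s hs') (hκle 2 s hs') (hκle 3 s hs') hκ0
  rw [he] at hform
  simp only [Pi.add_apply, sub_zero, div_one, one_mul, zero_mul, add_zero, add_sub_cancel] at hform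
  simp only [Fin.sum_univ_four, cornerAngleSum_zero, cornerAngleSum_one, cornerAngleSum_two,
    cornerAngleSum_three]
  linarith

theorem cornerAngleSum_le {r : Fin 4 → ℝ} {c M : ℝ} (i : Fin 4) (hr : ∀ j, 0 < r j) (hc : r i ≤ c)
    (hM : ∀ j, r j ≤ M) :
    cornerAngleSum r i ≤ angleSum (tanh c) (tanh M) (tanh M) (tanh M) := by
  have h : ∀ j k l, angleSum (tanh (r i)) (tanh (r j)) (tanh (r k)) (tanh (r l))
      ≤ angleSum (tanh c) (tanh M) (tanh M) (tanh M) := fun j k l =>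
    angleSum_mono (Real.tanh_mem_Ioo (hr i)).1 (Real.tanh_mem_Ioo (hr j)).1
      (Real.tanh_mem_Ioo (hr k)).1 (Real.tanh_mem_Ioo (hr l)).1
      (Real.tanh_monotone hc) (Real.tanh_monotone (hM j)) (Real.tanh_monotone (hM k))
      (Real.tanh_monotone (hM l)) (Real.tanh_lt_one _) (Real.tanh_lt_one _) (Real.tanh_lt_one _)
      (Real.tanh_lt_one _)
  fin_cases i
  · exact (cornerAngleSum_zero r).trans_le (h 1 2 3)
  · exact (cornerAngleSum_one r).trans_le (h 0 2 3)
  · exact (cornerAngleSum_two r).trans_le (h 0 1 3)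
  · exact (cornerAngleSum_three r).trans_le (h 0 1 2)

theorem angleSum_const {a t : ℝ} (ha : 0 < a) (ht : 0 < t) : angleSum a t t t
    = 3 * arccos (1 / 2 + (1 - a ^ 2) / (2 * (1 + t ^ 2 + 2 * a * t))) := by
  have h : edgeAngle a t t t = arccos (1 / 2 + (1 - a ^ 2) / (2 * (1 + t ^ 2 + 2 * a * t))) := by
    have hP := facePoly_pos ha ht ht
    have e : facePoly a t t = 1 + t ^ 2 + 2 * a * t := by unfold facePoly; ring
    rw [edgeAngle, Real.sqrt_mul_self hP.le, e]
    have : 0 < 1 + t ^ 2 + 2 * a * t := by positivity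
    congr 1
    unfold cosNumer
    field_simp
    ring
  rw [angleSum, h]; ring

theorem contDiffAt_edgeAngle {E : Type*} [NormedAddCommGroup E] [NormedSpace ℝ E]
    {n : WithTop ℕ∞} {a b x y : E → ℝ} {p : E} (ha : ContDiffAt ℝ n a p) (hb : ContDiffAt ℝ n b p)
    (hx : ContDiffAt ℝ n x p) (hy : ContDiffAt ℝ n y p)
    (ha0 : a p ∈ Set.Ioo (0 : ℝ) 1) (hb0 : b p ∈ Set.Ioo (0 : ℝ) 1)
    (hx0 : x p ∈ Set.Ioo (0 : ℝ) 1) (hy0 : y p ∈ Set.Ioo (0 : ℝ) 1) :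
    ContDiffAt ℝ n (fun p => edgeAngle (a p) (b p) (x p) (y p)) p := by
  have hD := gramDiscr_pos ha0 hb0 hx0 hy0
  have hP := facePoly_pos ha0.1 hb0.1 hx0.1
  have hQ := facePoly_pos ha0.1 hb0.1 hy0.1
  have hab : 0 < a p + b p := add_pos ha0.1 hb0.1
  have key := four_mul_facePoly_mul_sub (a p) (b p) (x p) (y p)
  have hPQ := mul_pos hP hQ
  have hr0 : 0 < √(facePoly (a p) (b p) (x p) * facePoly (a p) (b p) (y p)) := Real.sqrt_pos.2 hPQ
  have hr2 := Real.sq_sqrt hPQ.le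
  have hne : (cosNumer (a p) (b p) (x p) (y p) /
      (2 * √(facePoly (a p) (b p) (x p) * facePoly (a p) (b p) (y p)))) ^ 2 < 1 := by
    rw [div_pow, mul_pow, hr2, div_lt_one (by positivity)]
    have : 0 < (a p + b p) ^ 2 * gramDiscr (a p) (b p) (x p) (y p) := by positivity
    linarith
  have hN : ContDiffAt ℝ n (fun p => cosNumer (a p) (b p) (x p) (y p)) p := by
    unfold cosNumer; fun_prop
  have hF : ContDiffAt ℝ n
      (fun p => facePoly (a p) (b p) (x p) * facePoly (a p) (b p) (y p)) p := by
    unfold facePoly; fun_prop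
  exact (Real.contDiffAt_arccos (by intro h; rw [h] at hne; norm_num at hne)
    (by intro h; rw [h] at hne; norm_num at hne)).comp p
    (hN.div (contDiffAt_const.mul (hF.sqrt hPQ.ne')) (by positivity))

theorem contDiffAt_cornerAngleSum {E : Type*} [NormedAddCommGroup E] [NormedSpace ℝ E]
    {n : WithTop ℕ∞} {r : E → Fin 4 → ℝ} {p : E} (hr : ∀ i, ContDiffAt ℝ n (fun p => r p i) p)
    (hpos : ∀ i, 0 < r p i) (i : Fin 4) :
    ContDiffAt ℝ n (fun p => cornerAngleSum (r p) i) p := by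
  have h := fun j => (Real.contDiff_tanh (n := n)).contDiffAt.comp p (hr j)
  have h0 := fun j => Real.tanh_mem_Ioo (hpos j)
  exact ContDiffAt.sum fun j _ =>
    contDiffAt_edgeAngle (h i) (h j) (h _) (h _) (h0 i) (h0 j) (h0 _) (h0 _)

/-! ### Hyper-ideal tetrahedra with edge lengths `r i + r j` -/

namespace HyperidealTetrahedron

theorem lorentz_eq_of_hasLengths {P : HyperidealTetrahedron} {r : Fin 4 → ℝ}
    (hP : P.HasLengths fun i j => r i + r j) {i j : Fin 4} (h : i ≠ j) :
    lorentz (P.v i) (P.v j) = cosh (r i) * cosh (r j) * (-1 - tanh (r i) * tanh (r j)) := by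
  have h1 := P.cosh_length h
  rw [hP i j h, Real.cosh_add_eq_tanh] at h1
  linarith

/-- The normalization of `P.v i`, in the form matching the other entries of the Gram
matrix. -/
theorem lorentz_self_eq (P : HyperidealTetrahedron) (r : Fin 4 → ℝ) (i : Fin 4) :
    lorentz (P.v i) (P.v i) = cosh (r i) * cosh (r i) * (1 - tanh (r i) * tanh (r i)) := by
  rw [P.unit]
  linear_combination -Real.cosh_sq_mul_one_sub_tanh_sq (r i)

/-- The two cases needed are `k ≠ h`, where `m = 0`, and `k = h`, where `m = 2`. -/
theorem lorentz_normalPart {P : HyperidealTetrahedron} {r : Fin 4 → ℝ} (hr : ∀ i, 0 < r i)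
    (hP : P.HasLengths fun i j => r i + r j) {i j k h : Fin 4} (hij : i ≠ j) (hki : k ≠ i)
    (hkj : k ≠ j) (hhi : h ≠ i) (hhj : h ≠ j) {m : ℝ}
    (hm : lorentz (P.v k) (P.v h)
      = cosh (r k) * cosh (r h) * (m - 1 - tanh (r k) * tanh (r h))) :
    lorentz (P.normalPart i j k) (P.normalPart i j h) * (tanh (r i) + tanh (r j)) ^ 2
      = cosh (r k) * cosh (r h) * (m * (tanh (r i) + tanh (r j)) ^ 2
        + 2 * cosNumer (tanh (r i)) (tanh (r j)) (tanh (r k)) (tanh (r h))) := by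
  have ha := (Real.tanh_mem_Ioo (hr i)).1
  have hb := (Real.tanh_mem_Ioo (hr j)).1
  have hci := Real.cosh_pos (r i)
  have hcj := Real.cosh_pos (r j)
  have ei := Real.cosh_sq_mul_one_sub_tanh_sq (r i)
  have ej := Real.cosh_sq_mul_one_sub_tanh_sq (r j)
  have hden : 1 - lorentz (P.v i) (P.v j) ^ 2
      = -(cosh (r i) * cosh (r j) * (tanh (r i) + tanh (r j))) ^ 2 := by
    rw [lorentz_eq_of_hasLengths hP hij]
    calc _ = (cosh (r i) ^ 2 * (1 - tanh (r i) ^ 2)) * (cosh (r j) ^ 2 * (1 - tanh (r j) ^ 2))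
          - (cosh (r i) * cosh (r j) * (-1 - tanh (r i) * tanh (r j))) ^ 2 := by rw [ei, ej]; ring
      _ = _ := by ring
  have hα : ∀ l, l ≠ i → l ≠ j →
      (lorentz (P.v l) (P.v i) - lorentz (P.v i) (P.v j) * lorentz (P.v l) (P.v j))
        / (1 - lorentz (P.v i) (P.v j) ^ 2)
      = cosh (r l) / cosh (r i) * ((1 - tanh (r j) ^ 2
        + facePoly (tanh (r i)) (tanh (r j)) (tanh (r l))) / (tanh (r i) + tanh (r j)) ^ 2) := by
    intro l hli hlj
    rw [hden, lorentz_eq_of_hasLengths hP hij, lorentz_eq_of_hasLengths hP hli,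
      lorentz_eq_of_hasLengths hP hlj]
    rw [div_mul_div_comm, div_eq_div_iff (by
      rw [neg_ne_zero]; positivity) (by positivity)]
    unfold facePoly
    linear_combination (-(cosh (r l) * cosh (r i) * (1 + tanh (r i) * tanh (r l))) *
      (cosh (r i) * (tanh (r i) + tanh (r j)) ^ 2)) * (-ej)
  have hβ : ∀ l, l ≠ i → l ≠ j →
      (lorentz (P.v l) (P.v j) - lorentz (P.v i) (P.v j) * lorentz (P.v l) (P.v i))
        / (1 - lorentz (P.v i) (P.v j) ^ 2)
      = cosh (r l) / cosh (r j) * ((1 - tanh (r i) ^ 2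
        + facePoly (tanh (r i)) (tanh (r j)) (tanh (r l))) / (tanh (r i) + tanh (r j)) ^ 2) := by
    intro l hli hlj
    rw [hden, lorentz_eq_of_hasLengths hP hij, lorentz_eq_of_hasLengths hP hli,
      lorentz_eq_of_hasLengths hP hlj]
    rw [div_mul_div_comm, div_eq_div_iff (by
      rw [neg_ne_zero]; positivity) (by positivity)]
    unfold facePoly
    linear_combination (-(cosh (r l) * cosh (r j) * (1 + tanh (r j) * tanh (r l))) *
      (cosh (r j) * (tanh (r i) + tanh (r j)) ^ 2)) * (-ei)
  rw [normalPart, normalPart, lorentz_comb, hα k hki hkj, hα h hhi hhj, hβ k hki hkj, hβ h hhi hhj,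
    hm, lorentz_comm (P.v j) (P.v i), lorentz_comm (P.v i) (P.v h), lorentz_comm (P.v j) (P.v h),
    lorentz_eq_of_hasLengths hP hij, lorentz_eq_of_hasLengths hP hki,
    lorentz_eq_of_hasLengths hP hkj, lorentz_eq_of_hasLengths hP hhi,
    lorentz_eq_of_hasLengths hP hhj, lorentz_self_eq P r i, lorentz_self_eq P r j]
  unfold facePoly cosNumer
  have hab : tanh (r i) + tanh (r j) ≠ 0 := by positivity
  generalize tanh (r i) = a, tanh (r j) = b, tanh (r k) = x, tanh (r h) = y,
    cosh (r i) = ci, cosh (r j) = cj, cosh (r k) = ck, cosh (r h) = ch at *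
  field_simp
  ring

theorem dihedral_eq_edgeAngle {P : HyperidealTetrahedron} {r : Fin 4 → ℝ} (hr : ∀ i, 0 < r i)
    (hP : P.HasLengths fun i j => r i + r j) {i j : Fin 4} (hij : i ≠ j) :
    P.dihedral i j = edgeAngle (tanh (r i)) (tanh (r j)) (tanh (r (firstOther i j)))
      (tanh (r (lastOther i j))) := by
  obtain ⟨h1, h2, h3, h4, h5⟩ := firstOther_lastOther_spec i j hij
  rw [dihedral, edgeAngle]
  generalize firstOther i j = k, lastOther i j = h at *
  have ha := (Real.tanh_mem_Ioo (hr i)).1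
  have hb := (Real.tanh_mem_Ioo (hr j)).1
  have hx := (Real.tanh_mem_Ioo (hr k)).1
  have hy := (Real.tanh_mem_Ioo (hr h)).1
  have hck := Real.cosh_pos (r k)
  have hch := Real.cosh_pos (r h)
  have hs : 0 < tanh (r i) + tanh (r j) := add_pos ha hb
  have hx' := facePoly_pos ha hb hx
  have hy' := facePoly_pos ha hb hy
  have e1 := lorentz_normalPart hr hP hij h1 h2 h3 h4 (m := 0)
    (by rw [lorentz_eq_of_hasLengths hP h5]; ring)
  have e2 := lorentz_normalPart hr hP hij h1 h2 h1 h2 (m := 2)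
    (by rw [lorentz_self_eq P r]; ring)
  have e3 := lorentz_normalPart hr hP hij h3 h4 h3 h4 (m := 2)
    (by rw [lorentz_self_eq P r]; ring)
  have hself : ∀ x, 2 * (tanh (r i) + tanh (r j)) ^ 2
      + 2 * cosNumer (tanh (r i)) (tanh (r j)) x x
      = 4 * facePoly (tanh (r i)) (tanh (r j)) x := by
    intro x; unfold cosNumer facePoly; ring
  rw [hself] at e2 e3
  rw [zero_mul, zero_add] at e1
  rw [← eq_div_iff (by positivity)] at e1 e2 e3
  have f2 : cosh (r k) * cosh (r k) * (4 * facePoly (tanh (r i)) (tanh (r j)) (tanh (r k)))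
      / (tanh (r i) + tanh (r j)) ^ 2
      = (2 * cosh (r k) / (tanh (r i) + tanh (r j))) ^ 2
        * facePoly (tanh (r i)) (tanh (r j)) (tanh (r k)) := by rw [div_pow]; ring
  have f3 : cosh (r h) * cosh (r h) * (4 * facePoly (tanh (r i)) (tanh (r j)) (tanh (r h)))
      / (tanh (r i) + tanh (r j)) ^ 2
      = (2 * cosh (r h) / (tanh (r i) + tanh (r j))) ^ 2
        * facePoly (tanh (r i)) (tanh (r j)) (tanh (r h)) := by rw [div_pow]; ring
  rw [e1, e2, e3, f2, f3, Real.sqrt_mul (by positivity), Real.sqrt_mul (by positivity),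
    Real.sqrt_sq (by positivity), Real.sqrt_sq (by positivity), Real.sqrt_mul hx'.le]
  have := Real.sqrt_pos.2 hx'
  have := Real.sqrt_pos.2 hy'
  congr 1
  field_simp

theorem lorentz_endpoint (P : HyperidealTetrahedron) {i j : Fin 4} (h : i ≠ j) :
    lorentz (P.endpoint i j) (P.endpoint j i) = lorentz (P.v i) (P.v j) := by
  have hg := P.meets i j h
  have hpos : 0 < lorentz (P.v i) (P.v j) ^ 2 - 1 := by nlinarith
  have hs := Real.mul_self_sqrt hpos.le
  have e : lorentz (P.endpoint i j) (P.endpoint j i) =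
      (√(lorentz (P.v i) (P.v j) ^ 2 - 1) * √(lorentz (P.v i) (P.v j) ^ 2 - 1))⁻¹ *
        (lorentz (P.v i) (P.v j) - lorentz (P.v i) (P.v j) * lorentz (P.v j) (P.v j)
          - lorentz (P.v i) (P.v j) * lorentz (P.v i) (P.v i)
          + lorentz (P.v i) (P.v j) ^ 2 * lorentz (P.v i) (P.v j)) := by
    unfold endpoint
    rw [lorentz_comm (P.v j) (P.v i), mul_inv]
    generalize (√(lorentz (P.v i) (P.v j) ^ 2 - 1))⁻¹ = q
    simp only [lorentz, Pi.sub_apply, Pi.smul_apply, smul_eq_mul]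
    ring
  rw [e, P.unit, P.unit, hs, inv_mul_eq_iff_eq_mul₀ hpos.ne']
  ring

/-- The four vertices of a regular tetrahedron at height one; their mutual Lorentz products are
`2` on and `-2` off the diagonal. -/
def octant : Fin 4 → Fin 4 → ℝ :=
  ![![1, 1, 1, 1], ![1, -1, -1, 1], ![-1, 1, -1, 1], ![-1, -1, 1, 1]]

/-- The vector whose Lorentz product with `octant i` is `2 * t i`. -/
noncomputable def axisVec (t : Fin 4 → ℝ) : Fin 4 → ℝ :=
  ![(t 0 + t 1 - t 2 - t 3) / 2, (t 0 - t 1 + t 2 - t 3) / 2, (t 0 - t 1 - t 2 + t 3) / 2,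
    -(t 0 + t 1 + t 2 + t 3) / 2]

/-- Vectors are independent if their Gram matrix is nonsingular. Since the
matrix is a diagonal one plus a matrix of rank two, its kernel is found by solving for the two
numbers `∑ g i c i` and `∑ g i c i t i`. -/
theorem linearIndependent_of_gram {v : Fin 4 → Fin 4 → ℝ} {c t : Fin 4 → ℝ} (hc : ∀ i, c i ≠ 0)
    (hD : gramDiscr (t 0) (t 1) (t 2) (t 3) ≠ 0)
    (hv : ∀ i j, lorentz (v i) (v j)
      = c i * c j * ((if i = j then 2 else 0) - 1 - t i * t j)) :
    LinearIndependent ℝ v := by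
  rw [Fintype.linearIndependent_iff]
  intro g hg
  have h0 : ∀ j, g 0 * lorentz (v 0) (v j) + g 1 * lorentz (v 1) (v j)
      + g 2 * lorentz (v 2) (v j) + g 3 * lorentz (v 3) (v j) = 0 := by
    intro j
    have e : g 0 * lorentz (v 0) (v j) + g 1 * lorentz (v 1) (v j)
      + g 2 * lorentz (v 2) (v j) + g 3 * lorentz (v 3) (v j)
      = lorentz (∑ i, g i • v i) (v j) := by
      simp only [lorentz, Fin.sum_univ_four, Pi.add_apply, Pi.smul_apply, smul_eq_mul]
      ring
    rw [e, hg]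
    simp [lorentz]
  have h1 : ∀ j, 2 * (g j * c j) = (g 0 * c 0 + g 1 * c 1 + g 2 * c 2 + g 3 * c 3)
      + t j * (g 0 * c 0 * t 0 + g 1 * c 1 * t 1 + g 2 * c 2 * t 2 + g 3 * c 3 * t 3) := by
    intro j
    have h := h0 j
    simp only [hv] at h
    apply mul_left_cancel₀ (hc j)
    fin_cases j <;> simp [-mul_eq_mul_left_iff] at h ⊢ <;> linear_combination h
  set A := g 0 * c 0 + g 1 * c 1 + g 2 * c 2 + g 3 * c 3 with hA
  set B := g 0 * c 0 * t 0 + g 1 * c 1 * t 1 + g 2 * c 2 * t 2 + g 3 * c 3 * t 3 with hB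
  have e1 : 2 * A = -(B * (t 0 + t 1 + t 2 + t 3)) := by
    linear_combination (-2) * hA - h1 0 - h1 1 - h1 2 - h1 3
  have e2 : B * gramDiscr (t 0) (t 1) (t 2) (t 3) = 0 := by
    unfold gramDiscr
    linear_combination 4 * hB + 2 * t 0 * h1 0 + 2 * t 1 * h1 1 + 2 * t 2 * h1 2 + 2 * t 3 * h1 3
      + (t 0 + t 1 + t 2 + t 3) * e1
  have hB0 : B = 0 := (mul_eq_zero.1 e2).resolve_right hD
  have hA0 : A = 0 := by rw [hB0] at e1; linarith
  intro j
  have h := h1 j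
  rw [hA0, hB0] at h
  exact (mul_eq_zero.1 (by linarith : g j * c j = 0)).resolve_right (hc j)

/-- Every positive `r` is realized. The vectors `octant i + μ t i axisVec t`, divided
by `√2`, have Lorentz products `2 δ_ij - 1 - t i t j` if `μ` solves a quadratic equation, which has
a real root because `gramDiscr` is positive. -/
theorem exists_hasLengths {r : Fin 4 → ℝ} (hr : ∀ i, 0 < r i) :
    ∃ P : HyperidealTetrahedron, P.HasLengths fun i j => r i + r j := by
  set t : Fin 4 → ℝ := fun i => tanh (r i) with ht
  have ht0 : ∀ i, t i ∈ Set.Ioo (0 : ℝ) 1 := fun i => Real.tanh_mem_Ioo (hr i)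
  have hD := gramDiscr_pos (ht0 0) (ht0 1) (ht0 2) (ht0 3)
  set s := √(gramDiscr (t 0) (t 1) (t 2) (t 3)) / 2 with hs
  have hs0 : 0 < s := by positivity
  have hs2 : s ^ 2 = gramDiscr (t 0) (t 1) (t 2) (t 3) / 4 := by
    rw [hs, div_pow, Real.sq_sqrt hD.le]; norm_num
  -- `μ` is a root of `(1 - s ^ 2) * μ ^ 2 + 2 * μ + 1`, where `1 - s ^ 2` is half of the Lorentz
  -- square of `axisVec t`; this form of the root is valid for `s = 1` as well.
  set μ := -1 / (1 + s) with hμ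
  have hμs : μ * (1 + s) = -1 := by rw [hμ]; field_simp
  have hμ2 : μ ^ 2 * (1 - s ^ 2) + 2 * μ + 1 = 0 := by
    linear_combination (μ * (1 - s) + 1) * hμs
  have hsqrt : (√2)⁻¹ * (√2)⁻¹ = (1 / 2 : ℝ) := by
    rw [← mul_inv, Real.mul_self_sqrt (by norm_num)]; norm_num
  let v : Fin 4 → Fin 4 → ℝ := fun i =>
    (cosh (r i) * (√2)⁻¹) • (octant i + (μ * t i) • axisVec t)
  have hv : ∀ i j, lorentz (v i) (v j)
      = cosh (r i) * cosh (r j) * ((if i = j then 2 else 0) - 1 - t i * t j) := by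
    intro i j
    have e : lorentz (v i) (v j) = cosh (r i) * cosh (r j) * ((√2)⁻¹ * (√2)⁻¹) *
        (lorentz (octant i) (octant j) + μ * t j * lorentz (octant i) (axisVec t)
          + μ * t i * lorentz (octant j) (axisVec t)
          + μ ^ 2 * t i * t j * lorentz (axisVec t) (axisVec t)) := by
      simp only [v, lorentz, Pi.add_apply, Pi.smul_apply, smul_eq_mul]; ring
    have e1 : ∀ i, lorentz (octant i) (axisVec t) = 2 * t i := by
      intro i
      fin_cases i <;> simp [lorentz, octant, axisVec] <;> ring
    have e2 : lorentz (axisVec t) (axisVec t) = 2 * (1 - s ^ 2) := by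
      rw [hs2]; simp [lorentz, axisVec, gramDiscr]; ring
    have e3 : lorentz (octant i) (octant j) = 2 * ((if i = j then 2 else 0) - 1) := by
      fin_cases i <;> fin_cases j <;> simp [lorentz, octant] <;> norm_num
    rw [e, hsqrt, e1, e1, e2, e3]
    linear_combination cosh (r i) * cosh (r j) * (t i * t j) * hμ2
  have hoff : ∀ i j, i ≠ j → lorentz (v i) (v j) = -cosh (r i + r j) := by
    intro i j hij
    rw [hv, if_neg hij, Real.cosh_add_eq_tanh]; ring
  let P : HyperidealTetrahedron :=
    { v := v
      nondegenerate := linearIndependent_of_gram (fun i => (Real.cosh_pos (r i)).ne') hD.ne' hv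
      unit := fun i => by
        rw [hv, if_pos rfl]
        linear_combination Real.cosh_sq_mul_one_sub_tanh_sq (r i)
      meets := fun i j hij => by
        rw [hoff i j hij, neg_lt_neg_iff, Real.one_lt_cosh]
        linarith [hr i, hr j] }
  refine ⟨P, fun i j hij => ?_⟩
  have h : lorentz (P.v i) (P.v j) = -cosh (r i + r j) := hoff i j hij
  rw [length, lorentz_endpoint P hij, h, neg_neg,
    Real.arcosh_cosh (by linarith [hr i, hr j])]

theorem dihedralOfLengths_eq_edgeAngle {r : Fin 4 → ℝ} (hr : ∀ i, 0 < r i) {i j : Fin 4}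
    (hij : i ≠ j) : dihedralOfLengths (fun i j => r i + r j) i j
      = edgeAngle (tanh (r i)) (tanh (r j)) (tanh (r (firstOther i j)))
          (tanh (r (lastOther i j))) := by
  obtain ⟨P, hP⟩ := exists_hasLengths hr
  rw [dihedralOfLengths_eq hP, dihedral_eq_edgeAngle hr hP hij]

end HyperidealTetrahedron

/-! ### Scalar curvature and Euler characteristic -/

namespace FaceGluing

/-- A sum over pairs of distinct vertices of tetrahedra is a sum over corners and, for each
corner, over the three other vertices. -/
theorem sum_pair {T M : Type*} [Fintype T] [Fintype (Pair T)] [AddCommMonoid M]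
    (g : T × Fin 4 → Fin 4 → M) :
    ∑ x : Pair T, g (x.1.1, x.1.2.1) x.1.2.2
      = ∑ p : T × Fin 4, ∑ b ∈ Finset.univ.erase p.2, g p b := by
  classical
  rw [← Finset.sum_subtype (Finset.univ.filter fun x : T × Fin 4 × Fin 4 => x.2.1 ≠ x.2.2)
    (by simp) (fun x => g (x.1, x.2.1) x.2.2), Finset.sum_filter, Fintype.sum_prod_type,
    Fintype.sum_prod_type]
  refine Finset.sum_congr rfl fun σ _ => ?_
  rw [Fintype.sum_prod_type]
  refine Finset.sum_congr rfl fun a _ => ?_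
  rw [← Finset.sum_filter]
  refine Finset.sum_congr ?_ fun _ _ => rfl
  ext b
  simp [eq_comm]

variable {T : Type*} (𝒢 : FaceGluing T)

/-- The side of a vertex triangle to which a given side is glued. -/
def oppositeSide (x : Pair T) : Pair T :=
  ⟨(𝒢.adj x.1.1 x.1.2.2, 𝒢.perm x.1.1 x.1.2.2 x.1.2.1, 𝒢.perm x.1.1 x.1.2.2 x.1.2.2),
    fun h => x.2 ((𝒢.perm x.1.1 x.1.2.2).injective h)⟩

theorem linkSideRel_iff (x y : Pair T) : 𝒢.LinkSideRel x y ↔ y = 𝒢.oppositeSide x := by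
  rw [Subtype.ext_iff]
  rfl

/-- The edge of the link given by a side of a vertex triangle. -/
def linkEdge (x : Pair T) : 𝒢.LinkEdge := Quot.mk _ x

/-- The oriented edge of the triangulation given by an oriented edge of a
tetrahedron. -/
def orientedEdge (x : Pair T) : 𝒢.OrientedEdge := Quot.mk _ x

theorem oppositeSide_oppositeSide (x : Pair T) : 𝒢.oppositeSide (𝒢.oppositeSide x) = x := by
  apply Subtype.ext
  simp [oppositeSide, 𝒢.adj_adj, 𝒢.perm_perm]

theorem oppositeSide_ne (x : Pair T) : 𝒢.oppositeSide x ≠ x := by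
  intro h
  have h' := congrArg (fun y : Pair T => (y.1.1, y.1.2.2)) h
  exact 𝒢.face_ne x.1.1 x.1.2.2 h'

/-- Every edge of a link consists of two sides of vertex triangles, which
`oppositeSide` exchanges. -/
theorem linkEdge_eq_iff (x y : Pair T) :
    𝒢.linkEdge x = 𝒢.linkEdge y ↔ x = y ∨ x = 𝒢.oppositeSide y := by
  constructor
  · intro h
    let F : 𝒢.LinkEdge → Set (Pair T) := Quot.lift (fun x => {x, 𝒢.oppositeSide x}) (by
      intro x y hxy
      rw [linkSideRel_iff] at hxy
      rw [hxy, oppositeSide_oppositeSide, Set.pair_comm])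
    have hF : F (𝒢.linkEdge x) = F (𝒢.linkEdge y) := congrArg F h
    have hx : x ∈ F (𝒢.linkEdge x) := Or.inl rfl
    rw [hF] at hx
    exact hx
  · rintro (rfl | rfl)
    · rfl
    · exact (Quot.sound ((𝒢.linkSideRel_iff _ _).2 rfl)).symm

end FaceGluing

namespace IdealTriangulation

theorem isSpherePackingMetric_iff {T : Type*} (𝒯 : IdealTriangulation T) (r : 𝒯.Vertex → ℝ) :
    𝒯.IsSpherePackingMetric r ↔ ∀ i, 0 < r i :=
  ⟨fun h => h.1, fun h => ⟨h, fun _ =>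
    HyperidealTetrahedron.exists_hasLengths (r := fun a => r (𝒯.vertex _ a)) fun _ => h _⟩⟩

variable {T : Type*} [Fintype T] (𝒯 : IdealTriangulation T)

open FaceGluing

open Classical in
/-- The vertex triangles at a vertex have `3 d` sides altogether. -/
theorem card_sides (i : 𝒯.Vertex) :
    (Finset.univ.filter fun x : Pair T => 𝒯.vertex x.1.1 x.1.2.1 = i).card
      = 3 * 𝒯.degree i := by
  have h := sum_pair (T := T) fun p _ => if 𝒯.vertex p.1 p.2 = i then 1 else 0
  rw [Finset.card_filter, h, degree, Nat.card_eq_fintype_card, Fintype.card_subtype,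
    Finset.card_filter, Finset.mul_sum]
  refine Finset.sum_congr rfl fun p _ => ?_
  rw [Finset.sum_const, Finset.card_erase_of_mem (Finset.mem_univ _)]
  simp

/-- `2 E = 3 F` for the triangulation of a link. -/
theorem two_mul_card_linkEdge (i : 𝒯.Vertex) :
    2 * Nat.card {e : 𝒯.LinkEdge // 𝒯.linkEdgeVertex e = i} = 3 * 𝒯.degree i := by
  classical
  have : Finite 𝒯.LinkEdge := inferInstanceAs (Finite (Quot _))
  have := Fintype.ofFinite 𝒯.LinkEdge
  rw [← card_sides, Nat.card_eq_fintype_card, Fintype.card_subtype,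
    Finset.card_eq_sum_card_fiberwise (f := 𝒯.linkEdge)
      (t := Finset.univ.filter fun e : 𝒯.LinkEdge => 𝒯.linkEdgeVertex e = i)]
  · rw [Finset.sum_const_nat (m := 2), mul_comm]
    intro e he
    obtain ⟨y, rfl⟩ := Quot.exists_rep e
    have hy : 𝒯.linkEdgeVertex (𝒯.linkEdge y) = i := (Finset.mem_filter.1 he).2
    rw [Finset.card_eq_two]
    refine ⟨y, 𝒯.oppositeSide y, (𝒯.oppositeSide_ne y).symm, ?_⟩
    ext x
    simp only [Finset.mem_filter, Finset.mem_univ, true_and, Finset.mem_insert,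
      Finset.mem_singleton]
    rw [← linkEdge_eq_iff]
    refine ⟨fun h => h.2, fun h => ⟨?_, h⟩⟩
    rw [← hy, ← h]
    rfl
  · intro x hx
    exact Finset.mem_coe.2 (Finset.mem_filter.2
      ⟨Finset.mem_univ _, (Finset.mem_filter.1 (Finset.mem_coe.1 hx)).2⟩)

theorem degree_pos (i : 𝒯.Vertex) : 0 < 𝒯.degree i := by
  obtain ⟨x, rfl⟩ := Quot.exists_rep i
  have : Nonempty {y : T × Fin 4 // 𝒯.vertex y.1 y.2 = Quot.mk _ x} := ⟨⟨x, rfl⟩⟩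
  exact Nat.card_pos

instance : Finite 𝒯.Vertex := inferInstanceAs (Finite (Quot _))

open Classical in
/-- With `2 E = 3 F`, the Euler characteristic of the link is `V - F / 2`, and the
`2 π` of the edges at `i` add up to `2 π χ + π d`. -/
theorem scalarCurvature_eq {r : 𝒯.Vertex → ℝ} (hr : ∀ i, 0 < r i) (i : 𝒯.Vertex) :
    𝒯.scalarCurvature r i = 2 * π * 𝒯.eulerChar i
      + ∑ p : T × Fin 4 with 𝒯.vertex p.1 p.2 = i,
          (π - cornerAngleSum (fun a => r (𝒯.vertex p.1 a)) p.2) := by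
  have hangle : ∑ e : 𝒯.OrientedEdge with 𝒯.origin e = i,
      ∑ x : Pair T with (Quot.mk _ x : 𝒯.OrientedEdge) = e,
        dihedralOfLengths (𝒯.edgeLength r x.1.1) x.1.2.1 x.1.2.2
      = ∑ p : T × Fin 4 with 𝒯.vertex p.1 p.2 = i,
          cornerAngleSum (fun a => r (𝒯.vertex p.1 a)) p.2 := by
    have h1 := Finset.sum_fiberwise_of_maps_to
      (s := Finset.univ.filter fun x : Pair T => 𝒯.vertex x.1.1 x.1.2.1 = i)
      (t := Finset.univ.filter fun e : 𝒯.OrientedEdge => 𝒯.origin e = i)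
      (g := 𝒯.orientedEdge)
      (fun x hx => Finset.mem_filter.2 ⟨Finset.mem_univ _, (Finset.mem_filter.1 hx).2⟩)
      (fun x => dihedralOfLengths (𝒯.edgeLength r x.1.1) x.1.2.1 x.1.2.2)
    have h2 := sum_pair (T := T) fun p b => if 𝒯.vertex p.1 p.2 = i then
      dihedralOfLengths (𝒯.edgeLength r p.1) p.2 b else 0
    rw [← Finset.sum_filter, ← h1] at h2
    rw [Finset.sum_filter (s := Finset.univ) (p := fun p : T × Fin 4 => 𝒯.vertex p.1 p.2 = i)]
    convert! h2 using 1
    · refine Finset.sum_congr rfl fun e he => ?_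
      refine Finset.sum_congr ?_ fun _ _ => rfl
      ext x
      simp only [Finset.mem_filter, Finset.mem_univ, true_and] at he ⊢
      refine ⟨fun h => ⟨?_, h⟩, fun h => h.2⟩
      rw [← he, ← h]
      rfl
    · refine Finset.sum_congr rfl fun p _ => ?_
      split_ifs
      · refine Finset.sum_congr rfl fun b hb => ?_
        exact (HyperidealTetrahedron.dihedralOfLengths_eq_edgeAngle
          (r := fun a => r (𝒯.vertex p.1 a)) (fun _ => hr _) (Finset.ne_of_mem_erase hb).symm).symm
      · simp
  have hE := 𝒯.two_mul_card_linkEdge i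
  have hE' : (2 : ℝ) * Nat.card {e : 𝒯.LinkEdge // 𝒯.linkEdgeVertex e = i}
      = 3 * 𝒯.degree i := by exact_mod_cast hE
  have hV : ∑ e : 𝒯.OrientedEdge with 𝒯.origin e = i, (2 * π)
      = 2 * π * Nat.card {e : 𝒯.OrientedEdge // 𝒯.origin e = i} := by
    rw [Finset.sum_const, Nat.card_eq_fintype_card, Fintype.card_subtype, nsmul_eq_mul, mul_comm]
  have hF : ∑ p : T × Fin 4 with 𝒯.vertex p.1 p.2 = i, π = π * 𝒯.degree i := by
    rw [Finset.sum_const, degree, Nat.card_eq_fintype_card, Fintype.card_subtype, nsmul_eq_mul,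
      mul_comm]
  have hχ : (𝒯.eulerChar i : ℝ) = Nat.card {e : 𝒯.OrientedEdge // 𝒯.origin e = i}
      - Nat.card {e : 𝒯.LinkEdge // 𝒯.linkEdgeVertex e = i} + 𝒯.degree i := by
    rw [eulerChar, degree]; push_cast; ring
  simp only [scalarCurvature, ricciCurvature, Finset.sum_sub_distrib]
  rw [hangle, hV, hF, hχ]
  linear_combination π * hE'

end IdealTriangulation

/-! ### Estimates for the scalar curvature -/

/-- The argument of the inverse cosine in `constC₁` is the one in `constC₂` for
`c = M`, and the latter decreases in `c`. -/
theorem constC₁_lt_constC₂ (χ : ℤ) {d : ℕ} {M c : ℝ} (hd : 0 < d) (hc : 0 < c) (hcM : c < M) :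
    constC₁ χ d M < constC₂ χ d M c := by
  obtain ⟨hT, hT1⟩ := Real.tanh_mem_Ioo (hc.trans hcM)
  obtain ⟨hk, hk1⟩ := Real.tanh_mem_Ioo hc
  have hkT := Real.tanh_strictMono hcM
  have hd' : (0 : ℝ) < d := by exact_mod_cast hd
  unfold constC₁ constC₂
  generalize tanh M = t, tanh c = k at *
  have e : (1 + t ^ 2) / (1 + 3 * t ^ 2) = 1 / 2 + (1 - t ^ 2) / (2 * (1 + t ^ 2 + 2 * t * t)) := by
    have h1 : 0 < 1 + 3 * t ^ 2 := by positivity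
    have h2 : 0 < 1 + t ^ 2 + 2 * t * t := by positivity
    field_simp
    ring
  have hlt : (1 + t ^ 2) / (1 + 3 * t ^ 2)
      < 1 / 2 + (1 - k ^ 2) / (2 * (1 + t ^ 2 + 2 * k * t)) := by
    rw [e]
    have h1 : k ^ 2 < t ^ 2 := by gcongr
    have h2 : 0 < 1 - t ^ 2 := by nlinarith
    have h3 : 0 ≤ 1 - k ^ 2 := by linarith
    gcongr
  have hle : 1 / 2 + (1 - k ^ 2) / (2 * (1 + t ^ 2 + 2 * k * t)) ≤ 1 := by
    have : (1 - k ^ 2) / (2 * (1 + t ^ 2 + 2 * k * t)) ≤ 1 / 2 := by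
      rw [div_le_div_iff₀ (by positivity) (by norm_num)]
      nlinarith [mul_pos hk hT]
    linarith
  have hpos : 0 < (1 + t ^ 2) / (1 + 3 * t ^ 2) := by positivity
  have := Real.strictAntiOn_arccos ⟨by linarith, by linarith⟩ ⟨by linarith, hle⟩ hlt
  nlinarith

namespace IdealTriangulation

variable {T : Type*} [Fintype T] (𝒯 : IdealTriangulation T)

theorem scalarCurvature_strongly_antitone [Fintype 𝒯.Vertex] {δ M : ℝ} (hδ : 0 < δ) :
    ∃ lam > 0, ∀ r r' : 𝒯.Vertex → ℝ, (∀ i, r i ∈ Set.Icc δ M) → (∀ i, r' i ∈ Set.Icc δ M) →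
      ∑ i, (r' i - r i) * (𝒯.scalarCurvature r' i - 𝒯.scalarCurvature r i)
        ≤ -(lam * ∑ i, (r' i - r i) ^ 2) := by
  classical
  obtain ⟨lam, hlam, h⟩ := cornerAngleSum_strongly_monotone (M := M) hδ
  refine ⟨lam, hlam, fun r r' hr hr' => ?_⟩
  have hK : ∀ i, (r' i - r i) * (𝒯.scalarCurvature r' i - 𝒯.scalarCurvature r i)
      = -∑ p : T × Fin 4 with 𝒯.vertex p.1 p.2 = i,
        (r' (𝒯.vertex p.1 p.2) - r (𝒯.vertex p.1 p.2))
          * (cornerAngleSum (fun a => r' (𝒯.vertex p.1 a)) p.2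
            - cornerAngleSum (fun a => r (𝒯.vertex p.1 a)) p.2) := by
    intro i
    rw [scalarCurvature_eq 𝒯 (fun i => hδ.trans_le (hr i).1),
      scalarCurvature_eq 𝒯 (fun i => hδ.trans_le (hr' i).1), add_sub_add_left_eq_sub,
      ← Finset.sum_sub_distrib, Finset.mul_sum, ← Finset.sum_neg_distrib]
    refine Finset.sum_congr rfl fun p hp => ?_
    rw [(Finset.mem_filter.1 hp).2]
    ring
  have hfib : ∀ f : T × Fin 4 → ℝ, ∑ i, ∑ p with 𝒯.vertex p.1 p.2 = i, f p
      = ∑ σ, ∑ a, f (σ, a) := fun f => by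
    rw [← Fintype.sum_prod_type]
    exact Finset.sum_fiberwise Finset.univ (fun p : T × Fin 4 => 𝒯.vertex p.1 p.2) f
  rw [Finset.sum_congr rfl fun i _ => hK i, Finset.sum_neg_distrib, neg_le_neg_iff, hfib]
  calc lam * ∑ i, (r' i - r i) ^ 2
      ≤ lam * ∑ i, ∑ p : T × Fin 4 with 𝒯.vertex p.1 p.2 = i,
          (r' (𝒯.vertex p.1 p.2) - r (𝒯.vertex p.1 p.2)) ^ 2 := by
        refine mul_le_mul_of_nonneg_left (Finset.sum_le_sum fun i _ => ?_) hlam.le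
        obtain ⟨p, rfl⟩ := Quot.exists_rep i
        exact Finset.single_le_sum (f := fun p : T × Fin 4 =>
          (r' (𝒯.vertex p.1 p.2) - r (𝒯.vertex p.1 p.2)) ^ 2) (fun _ _ => sq_nonneg _)
          (Finset.mem_filter.2 ⟨Finset.mem_univ p, rfl⟩)
    _ = ∑ σ : T, lam * ∑ a, (r' (𝒯.vertex σ a) - r (𝒯.vertex σ a)) ^ 2 := by
        rw [hfib, Finset.mul_sum]
    _ ≤ _ := Finset.sum_le_sum fun σ _ => h (fun a => r (𝒯.vertex σ a))
        (fun a => r' (𝒯.vertex σ a)) (fun _ => hr _) (fun _ => hr' _)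

theorem constC₂_le_scalarCurvature {r : 𝒯.Vertex → ℝ} {M c : ℝ} {i : 𝒯.Vertex} (hM : 0 < M)
    (hc : 0 < c) (hr : ∀ j, 0 < r j) (hrM : ∀ j, r j ≤ M) (hri : r i ≤ c) :
    constC₂ (𝒯.eulerChar i) (𝒯.degree i) M c ≤ 𝒯.scalarCurvature r i := by
  classical
  rw [scalarCurvature_eq 𝒯 hr, constC₂,
    ← angleSum_const (Real.tanh_mem_Ioo hc).1 (Real.tanh_mem_Ioo hM).1]
  refine add_le_add le_rfl ?_
  rw [degree, Nat.card_eq_fintype_card, Fintype.card_subtype, ← nsmul_eq_mul]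
  refine Finset.card_nsmul_le_sum _ _ _ fun p hp => sub_le_sub_left ?_ _
  exact cornerAngleSum_le _ (fun _ => hr _)
    ((congrArg r (Finset.mem_filter.1 hp).2).trans_le hri) fun _ => hrM _

theorem exists_lipschitzOnWith_scalarCurvature [Fintype 𝒯.Vertex] {δ M : ℝ} (hδ : 0 < δ) :
    ∃ C, LipschitzOnWith C 𝒯.scalarCurvature
      (Set.Icc (fun _ => δ : 𝒯.Vertex → ℝ) fun _ => M) := by
  classical
  refine ContDiffOn.exists_lipschitzOnWith (n := 1) ?_ one_ne_zero (convex_Icc _ _) isCompact_Icc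
  have hpos : ∀ r ∈ Set.Icc (fun _ => δ : 𝒯.Vertex → ℝ) (fun _ => M), ∀ i, 0 < r i :=
    fun r hr i => hδ.trans_le (hr.1 i)
  refine contDiffOn_pi.2 fun i => ContDiffOn.congr ?_ fun r hr => scalarCurvature_eq 𝒯 (hpos r hr) i
  refine contDiffOn_const.add (ContDiffOn.sum fun p _ => contDiffOn_const.sub ?_)
  exact fun r hr => (contDiffAt_cornerAngleSum
    (r := fun (r : 𝒯.Vertex → ℝ) a => r (𝒯.vertex p.1 a)) (fun a => contDiffAt_apply _ _ _ _)
    (fun _ => hpos r hr _) _).contDiffWithinAt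

end IdealTriangulation

/-! ### Ordinary differential equations with Lipschitz right-hand side -/

section RealAnalysis

open Set Filter Topology NNReal

/-- A bounded, globally Lipschitz vector field has
integral curves for all positive times. -/
theorem exists_forall_hasDerivWithinAt_Ici_of_lipschitzWith {E : Type*} [NormedAddCommGroup E]
    [NormedSpace ℝ E] [CompleteSpace E] {f : E → E} {K L : ℝ≥0} (hf : LipschitzWith K f)
    (hL : ∀ x, ‖f x‖ ≤ L) (x₀ : E) :
    ∃ α : ℝ → E, α 0 = x₀ ∧ ∀ t ≥ 0, HasDerivWithinAt α (f (α t)) (Ici 0) t := by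
  have hloc : ∀ n : ℕ, ∃ α : ℝ → E, α 0 = x₀ ∧
      ∀ t ∈ Icc (0 : ℝ) (n + 1), HasDerivWithinAt α (f (α t)) (Icc 0 (n + 1)) t := by
    intro n
    have h0 : (0 : ℝ) ∈ Icc (0 : ℝ) (n + 1) := ⟨le_rfl, by positivity⟩
    have hPL : IsPicardLindelof (fun _ => f) (⟨0, h0⟩ : Icc (0 : ℝ) (n + 1)) x₀
        (L * (n + 1)) 0 L K :=
      { lipschitzOnWith := fun _ _ => hf.lipschitzOnWith
        continuousOn := fun _ _ => continuousOn_const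
        norm_le := fun _ _ x _ => hL x
        mul_max_le := by
          have : max ((n : ℝ) + 1) 0 = n + 1 := max_eq_left (by positivity)
          simp [this] }
    exact hPL.exists_eq_forall_mem_Icc_hasDerivWithinAt₀
  choose α hα0 hα using hloc
  have hright : ∀ n : ℕ, ∀ t ∈ Ico (0 : ℝ) (n + 1), HasDerivWithinAt (α n) (f (α n t)) (Ici t) t :=
    fun n t ht => (hα n t ⟨ht.1, ht.2.le⟩).mono_of_mem_nhdsWithin
      (mem_of_superset (Icc_mem_nhdsGE ht.2) (Icc_subset_Icc_left ht.1))
  have huniq : ∀ m n : ℕ, m ≤ n → ∀ t ∈ Icc (0 : ℝ) (m + 1), α m t = α n t := by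
    intro m n hmn
    have hle : (m : ℝ) + 1 ≤ n + 1 := by gcongr
    refine ODE_solution_unique (v := fun _ => f) (fun _ => hf)
      (fun t ht => (hα m t ht).continuousWithinAt) (hright m) ?_ ?_ ?_
    · exact fun t ht => ((hα n t ⟨ht.1, ht.2.trans hle⟩).continuousWithinAt).mono
        (Icc_subset_Icc_right hle)
    · exact fun t ht => hright n t ⟨ht.1, ht.2.trans_le hle⟩
    · rw [hα0, hα0]
  have hglue : ∀ n : ℕ, ∀ t ∈ Ico (0 : ℝ) (n + 1), α ⌊t⌋₊ t = α n t := by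
    intro n t ht
    refine huniq _ n ?_ t ⟨ht.1, (Nat.lt_floor_add_one t).le⟩
    have : ⌊t⌋₊ < n + 1 := (Nat.floor_lt ht.1).2 (by exact_mod_cast ht.2)
    omega
  -- The solutions `α n` on `[0, n + 1]` extend each other.
  refine ⟨fun t => α ⌊t⌋₊ t, by simp [hα0], fun t ht => ?_⟩
  have htn := Nat.lt_floor_add_one t
  have hnhds : Ico (0 : ℝ) (⌊t⌋₊ + 1) ∈ 𝓝[Ici 0] t := by
    rw [← Ici_inter_Iio]
    exact inter_mem_nhdsWithin _ (Iio_mem_nhds htn)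
  have h := (hα ⌊t⌋₊ t ⟨ht, htn.le⟩).mono_of_mem_nhdsWithin
    (mem_of_superset hnhds Ico_subset_Icc_self)
  exact h.congr_of_eventuallyEq (mem_of_superset hnhds (hglue _)) rfl

/-- If `F` is Lipschitz on a box, then precomposing it
with the projection to the box gives a vector field with global integral curves; they solve the
equation for `F` whenever they are in the box. -/
theorem exists_hasDerivWithinAt_of_lipschitzOnWith_box {V : Type*} [Fintype V]
    {F : (V → ℝ) → V → ℝ} {δ M : ℝ} (hδM : δ ≤ M) {C : ℝ≥0}
    (hF : LipschitzOnWith C F (Icc (fun _ => δ) fun _ => M)) (r₀ : V → ℝ) :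
    ∃ r : ℝ → V → ℝ, r 0 = r₀ ∧ ContinuousOn r (Ici 0) ∧
      ∀ t ≥ 0, r t ∈ Icc (fun _ => δ) (fun _ => M) →
        HasDerivWithinAt r (F (r t)) (Ici 0) t := by
  let q : (V → ℝ) → V → ℝ := fun r i => max δ (min M (r i))
  have hq : LipschitzWith 1 q := LipschitzWith.of_dist_le_mul fun r s => by
    rw [NNReal.coe_one, one_mul]
    refine (dist_pi_le_iff dist_nonneg).2 fun i => le_trans ?_ (dist_le_pi_dist r s i)
    have h : LipschitzWith 1 fun x : ℝ => max δ (min M x) :=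
      (LipschitzWith.id.const_min M).const_max δ
    simpa using h.dist_le_mul (r i) (s i)
  have hmem : ∀ r, q r ∈ Icc (fun _ => δ : V → ℝ) fun _ => M := fun r =>
    ⟨fun i => le_max_left _ _, fun i => max_le hδM (min_le_left _ _)⟩
  have hid : ∀ r ∈ Icc (fun _ => δ : V → ℝ) fun _ => M, q r = r := fun r hr => funext fun i => by
    simp only [q]
    rw [min_eq_right (hr.2 i), max_eq_right (hr.1 i)]
  have hlip : LipschitzWith (C * 1) (F ∘ q) := by
    rw [← lipschitzOnWith_univ] at hq ⊢
    exact hF.comp hq fun r _ => hmem r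
  obtain ⟨L, hL⟩ := isCompact_Icc.exists_bound_of_continuousOn hF.continuousOn
  obtain ⟨r, hr0, hr⟩ := exists_forall_hasDerivWithinAt_Ici_of_lipschitzWith
    (L := L.toNNReal) hlip (fun x => (hL _ (hmem x)).trans (Real.le_coe_toNNReal L)) r₀
  refine ⟨r, hr0, fun t ht => (hr t ht).continuousWithinAt, fun t ht hrt => ?_⟩
  have h := hr t ht
  rwa [Function.comp_apply, hid _ hrt] at h

/-- If a curve cannot leave the closed set `A` while it is in the open
neighbourhood `U` of `A`, then it never leaves `A`. -/
theorem forall_mem_of_forall_Ico {E : Type*} [TopologicalSpace E] {r : ℝ → E} {U A : Set E}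
    (hr : ContinuousOn r (Ici 0)) (hU : IsOpen U) (hA : IsClosed A) (hAU : A ⊆ U)
    (h0 : r 0 ∈ U)
    (h : ∀ τ > 0, (∀ t ∈ Ico 0 τ, r t ∈ U) → ∀ t ∈ Ico 0 τ, r t ∈ A) :
    ∀ t ≥ 0, r t ∈ A := by
  have hall : ∀ t ≥ 0, r t ∈ U := by
    by_contra! hne
    set S := Ici (0 : ℝ) ∩ r ⁻¹' Uᶜ with hS
    have hSc : IsClosed S := hr.preimage_isClosed_of_isClosed isClosed_Ici hU.isClosed_compl
    have hSn : S.Nonempty := hne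
    have hSb : BddBelow S := ⟨0, fun t ht => ht.1⟩
    have hτ := hSc.csInf_mem hSn hSb
    set τ := sInf S
    have hτ0 : 0 < τ := lt_of_le_of_ne hτ.1 fun h => hτ.2 (h ▸ h0)
    have hIco : ∀ t ∈ Ico 0 τ, r t ∈ U := fun t ht => by
      by_contra hn
      exact absurd (csInf_le hSb ⟨ht.1, hn⟩) (not_le.2 ht.2)
    have hA' := h τ hτ0 hIco
    have hcl : r τ ∈ closure A := ((hr τ hτ.1).mono Ico_subset_Ici_self).mem_closure
      (by rw [closure_Ico hτ0.ne]; exact ⟨hτ.1, le_rfl⟩) hA'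
    rw [hA.closure_eq] at hcl
    exact hτ.2 (hAU hcl)
  exact fun t ht => h (t + 1) (by linarith) (fun s hs => hall s hs.1) t ⟨ht, by linarith⟩

/-- A function that does not decrease where it is at most `c` stays above
each `δ ≤ c` that is below its initial value. -/
theorem le_of_deriv_nonneg_of_le {f f' : ℝ → ℝ} {δ c τ : ℝ}
    (hf : ∀ t ∈ Ico 0 τ, HasDerivWithinAt f (f' t) (Ico 0 τ) t) (hδ : δ ≤ c) (h0 : δ ≤ f 0)
    (h : ∀ t ∈ Ico 0 τ, f t ≤ c → 0 ≤ f' t) : ∀ t ∈ Ico 0 τ, δ ≤ f t := by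
  intro t₁ ht₁
  by_contra! hlt
  have hsub : Icc 0 t₁ ⊆ Ico 0 τ := fun s hs => ⟨hs.1, hs.2.trans_lt ht₁.2⟩
  have hcont : ContinuousOn f (Icc 0 t₁) := fun s hs =>
    (hf s (hsub hs)).continuousWithinAt.mono hsub
  set S := Icc 0 t₁ ∩ f ⁻¹' Ici δ
  have hSc : IsClosed S := hcont.preimage_isClosed_of_isClosed isClosed_Icc isClosed_Ici
  have hSn : S.Nonempty := ⟨0, ⟨le_rfl, ht₁.1⟩, h0⟩
  have hSb : BddAbove S := ⟨t₁, fun s hs => hs.1.2⟩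
  have hs := hSc.csSup_mem hSn hSb
  set s := sSup S
  have hlt' : ∀ u ∈ Ioo s t₁, f u < δ := fun u hu => by
    by_contra! hn
    exact absurd (le_csSup hSb ⟨⟨hs.1.1.trans hu.1.le, hu.2.le⟩, hn⟩) (not_le.2 hu.1)
  have hsub' : Icc s t₁ ⊆ Icc 0 t₁ := Icc_subset_Icc_left hs.1.1
  have hmono : MonotoneOn f (Icc s t₁) := by
    refine monotoneOn_of_hasDerivWithinAt_nonneg (f' := f') (convex_Icc _ _) (hcont.mono hsub')
      (fun u hu => ?_) fun u hu => ?_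
    · exact (hf u (hsub (hsub' (interior_subset hu)))).mono
        (interior_subset.trans (hsub'.trans hsub))
    · rw [interior_Icc] at hu
      exact h u (hsub (hsub' (Ioo_subset_Icc_self hu))) ((hlt' u hu).le.trans hδ)
  have := hmono ⟨le_rfl, hs.1.2⟩ ⟨hs.1.2, le_rfl⟩ hs.1.2
  exact absurd (hs.2.trans this) (not_le.2 hlt)

theorem exists_pos_forall_le {V : Type*} [Finite V] {r : V → ℝ} (hr : ∀ i, 0 < r i) :
    ∃ δ > 0, ∀ i, δ ≤ r i := by
  have h : ∀ᶠ δ in 𝓝[>] (0 : ℝ), ∀ i, δ ≤ r i := Filter.eventually_all.2 fun i =>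
    Filter.Eventually.filter_mono nhdsWithin_le_nhds (Iic_mem_nhds (hr i))
  obtain ⟨δ, hδ, hδ0⟩ := (h.and self_mem_nhdsWithin).exists
  exact ⟨δ, hδ0, hδ⟩

theorem exists_forall_le {V : Type*} [Finite V] (r : V → ℝ) : ∃ M, ∀ i, r i ≤ M := by
  obtain ⟨M, hM⟩ := (Set.finite_range r).bddAbove
  exact ⟨M, fun i => hM ⟨i, rfl⟩⟩

theorem abs_sub_le_of_sum_sq_le {V : Type*} [Fintype V] {r s : V → ℝ} {B : ℝ} (hB : 0 ≤ B)
    (h : ∑ i, (r i - s i) ^ 2 ≤ B ^ 2) (i : V) : |r i - s i| ≤ B :=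
  abs_le_of_sq_le_sq ((Finset.single_le_sum (f := fun i => (r i - s i) ^ 2)
    (fun _ _ => sq_nonneg _) (Finset.mem_univ i)).trans h) hB

theorem isOpen_box {V : Type*} [Finite V] (δ M : ℝ) : IsOpen {r : V → ℝ | ∀ i, r i ∈ Ioo δ M} := by
  simpa [Set.pi] using isOpen_set_pi (s := fun _ : V => Ioo δ M) Set.finite_univ
    (fun _ _ => isOpen_Ioo)

end RealAnalysis

/-! ### The combinatorial Ricci flow -/

namespace IdealTriangulation

open Set Topology

variable {T : Type*} [Fintype T] (𝒯 : IdealTriangulation T)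

theorem scalarCurvature_antitone [Fintype 𝒯.Vertex] {r r' : 𝒯.Vertex → ℝ} (hr : ∀ i, 0 < r i)
    (hr' : ∀ i, 0 < r' i) :
    ∑ i, (r' i - r i) * (𝒯.scalarCurvature r' i - 𝒯.scalarCurvature r i) ≤ 0 := by
  obtain ⟨δ, hδ, h1⟩ := exists_pos_forall_le hr
  obtain ⟨δ', hδ', h1'⟩ := exists_pos_forall_le hr'
  obtain ⟨M, h2⟩ := exists_forall_le r
  obtain ⟨M', h2'⟩ := exists_forall_le r'
  obtain ⟨lam, hlam, h⟩ := 𝒯.scalarCurvature_strongly_antitone (M := max M M') (lt_min hδ hδ')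
  refine (h r r' (fun i => ⟨(min_le_left _ _).trans (h1 i), (h2 i).trans (le_max_left _ _)⟩)
    fun i => ⟨(min_le_right _ _).trans (h1' i), (h2' i).trans (le_max_right _ _)⟩).trans ?_
  have : 0 ≤ ∑ i, (r' i - r i) ^ 2 := Finset.sum_nonneg fun _ _ => sq_nonneg _
  rw [neg_nonpos]
  positivity

variable {𝒯}

theorem isRicciFlow_const {Kbar rbar : 𝒯.Vertex → ℝ} (hrbar : 𝒯.IsSpherePackingMetric rbar)
    (hK : ∀ i, 𝒯.scalarCurvature rbar i = Kbar i) (I : Set ℝ) :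
    𝒯.IsRicciFlow Kbar rbar I fun _ => rbar :=
  ⟨rfl, fun t _ => ⟨hrbar, fun i => by
    rw [hK i, sub_self]; exact hasDerivWithinAt_const t I (rbar i)⟩⟩

/-- The squared Euclidean distance of two solutions decays at the rate
`2 lam`, if the curvature map is strongly antitone with constant `lam` along them. -/
theorem IsRicciFlow.sum_sq_sub_le [Fintype 𝒯.Vertex] {Kbar r₀ s₀ : 𝒯.Vertex → ℝ} {I : Set ℝ}
    {r s : ℝ → 𝒯.Vertex → ℝ} {lam : ℝ} (hI : Convex ℝ I) (h0 : 0 ∈ I)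
    (hr : 𝒯.IsRicciFlow Kbar r₀ I r) (hs : 𝒯.IsRicciFlow Kbar s₀ I s)
    (h : ∀ t ∈ I, ∑ i, (r t i - s t i)
      * (𝒯.scalarCurvature (r t) i - 𝒯.scalarCurvature (s t) i)
        ≤ -(lam * ∑ i, (r t i - s t i) ^ 2)) {t : ℝ} (ht : t ∈ I) (ht0 : 0 ≤ t) :
    ∑ i, (r t i - s t i) ^ 2 ≤ exp (-(2 * lam * t)) * ∑ i, (r₀ i - s₀ i) ^ 2 := by
  have hd : ∀ t ∈ I, HasDerivWithinAt
      (fun t => exp (2 * lam * t) * ∑ i, (r t i - s t i) ^ 2)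
      (exp (2 * lam * t) * (2 * lam) * ∑ i, (r t i - s t i) ^ 2
        + exp (2 * lam * t) * ∑ i, 2 * ((r t i - s t i)
          * (𝒯.scalarCurvature (r t) i - 𝒯.scalarCurvature (s t) i))) I t := by
    intro t ht
    have he : HasDerivWithinAt (fun t => exp (2 * lam * t)) (exp (2 * lam * t) * (2 * lam))
        I t := by
      simpa using (((hasDerivAt_id t).const_mul (2 * lam)).exp).hasDerivWithinAt
    refine he.mul (HasDerivWithinAt.fun_sum fun i _ => ?_)
    convert! (((hr.2 t ht).2 i).sub ((hs.2 t ht).2 i)).pow 2 using 1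
    simp
    ring
  have hanti : AntitoneOn (fun t => exp (2 * lam * t) * ∑ i, (r t i - s t i) ^ 2) I := by
    refine antitoneOn_of_hasDerivWithinAt_nonpos hI (fun t ht => (hd t ht).continuousWithinAt)
      (fun t ht => (hd t (interior_subset ht)).mono interior_subset) fun t ht => ?_
    rw [← Finset.mul_sum]
    have h1 := h t (interior_subset ht)
    have h2 := mul_le_mul_of_nonneg_left h1 (exp_pos (2 * lam * t)).le
    linarith
  have h1 := hanti h0 ht ht0
  simp only [mul_zero, exp_zero, one_mul, hr.1, hs.1] at h1
  rwa [exp_neg, ← div_eq_inv_mul, le_div_iff₀' (exp_pos _)]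

theorem IsRicciFlow.eq_of_mem [Fintype 𝒯.Vertex] {Kbar r₀ : 𝒯.Vertex → ℝ} {τ t : ℝ}
    {r r' : ℝ → 𝒯.Vertex → ℝ} (hr : 𝒯.IsRicciFlow Kbar r₀ (Ico 0 τ) r)
    (hr' : 𝒯.IsRicciFlow Kbar r₀ (Ico 0 τ) r') (ht : t ∈ Ico 0 τ) : r t = r' t := by
  have h := hr.sum_sq_sub_le (lam := 0) (convex_Ico 0 τ) ⟨le_rfl, ht.1.trans_lt ht.2⟩ hr'
    (fun t ht => by
      simpa using 𝒯.scalarCurvature_antitone (hr'.2 t ht).1.1 (hr.2 t ht).1.1) ht ht.1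
  ext i
  have := abs_sub_le_of_sum_sq_le le_rfl (h.trans (by simp)) i
  exact sub_eq_zero.1 (abs_nonpos_iff.1 this)

variable (𝒯)

/-- A curve, defined for all times, that solves the Ricci flow as long as it
stays in the box `(δ, M)`. -/
theorem exists_clamped_flow [Fintype 𝒯.Vertex] (Kbar r₀ : 𝒯.Vertex → ℝ) {δ M : ℝ} (hδ : 0 < δ)
    (hδM : δ ≤ M) : ∃ r : ℝ → 𝒯.Vertex → ℝ, r 0 = r₀ ∧ ContinuousOn r (Ici 0) ∧
      ∀ I ⊆ Ici 0, (∀ t ∈ I, ∀ i, r t i ∈ Ioo δ M) → 𝒯.IsRicciFlow Kbar r₀ I r := by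
  obtain ⟨C, hC⟩ := 𝒯.exists_lipschitzOnWith_scalarCurvature (M := M) hδ
  have hF : LipschitzOnWith (C + 0) (fun r : 𝒯.Vertex → ℝ => 𝒯.scalarCurvature r - Kbar)
      (Icc (fun _ => δ) fun _ => M) := hC.sub (LipschitzWith.const Kbar).lipschitzOnWith
  obtain ⟨r, hr0, hrc, hr⟩ := exists_hasDerivWithinAt_of_lipschitzOnWith_box hδM hF r₀
  refine ⟨r, hr0, hrc, fun I hI hmem => ⟨hr0, fun t ht => ⟨?_, fun i => ?_⟩⟩⟩
  · exact (𝒯.isSpherePackingMetric_iff _).2 fun i => hδ.trans (hmem t ht i).1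
  · exact (hasDerivWithinAt_pi.1 ((hr t (hI ht)
      ⟨fun i => (hmem t ht i).1.le, fun i => (hmem t ht i).2.le⟩).mono hI)) i

theorem exists_isRicciFlow_Ico [Fintype 𝒯.Vertex] (Kbar : 𝒯.Vertex → ℝ) {r₀ : 𝒯.Vertex → ℝ}
    (hr₀ : 𝒯.IsSpherePackingMetric r₀) : ∃ τ > 0, ∃ r, 𝒯.IsRicciFlow Kbar r₀ (Ico 0 τ) r := by
  obtain ⟨δ, hδ, h1⟩ := exists_pos_forall_le hr₀.1
  obtain ⟨M, h2⟩ := exists_forall_le r₀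
  obtain ⟨r, hr0, hrc, hr⟩ := 𝒯.exists_clamped_flow Kbar r₀ (half_pos hδ)
    (M := max (δ / 2) (M + 1)) (le_max_left _ _)
  have hmem : r 0 ∈ {r : 𝒯.Vertex → ℝ | ∀ i, r i ∈ Ioo (δ / 2) (max (δ / 2) (M + 1))} := by
    rw [hr0]
    exact fun i => ⟨by linarith [h1 i], lt_max_of_lt_right (by linarith [h2 i])⟩
  have hnhds := hrc 0 (mem_Ici.2 le_rfl) ((isOpen_box _ _).mem_nhds hmem)
  obtain ⟨τ, hτ, hsub⟩ := (mem_nhdsGE_iff_exists_Ico_subset).1 hnhds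
  exact ⟨τ, hτ, r, hr _ Ico_subset_Ici_self fun t ht => hsub ht⟩

theorem exists_isFlowBound [Fintype 𝒯.Vertex] {Kbar rbar : 𝒯.Vertex → ℝ}
    (hrbar : 𝒯.IsSpherePackingMetric rbar) (hK : ∀ i, 𝒯.scalarCurvature rbar i = Kbar i)
    (r₀ : 𝒯.Vertex → ℝ) : ∃ M > 0, 𝒯.IsFlowBound Kbar r₀ M := by
  obtain ⟨M, hM⟩ := exists_forall_le rbar
  set B := ∑ i, (r₀ i - rbar i) ^ 2 with hB
  have hB0 : 0 ≤ B := Finset.sum_nonneg fun _ _ => sq_nonneg _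
  refine ⟨|M| + √B + 1, by positivity, fun τ r hr t ht i => ?_⟩
  have h := hr.sum_sq_sub_le (lam := 0) (convex_Ico 0 τ) ⟨le_rfl, ht.1.trans_lt ht.2⟩
    (isRicciFlow_const hrbar hK _) (fun t ht => by
      simpa using 𝒯.scalarCurvature_antitone hrbar.1 (hr.2 t ht).1.1) ht ht.1
  have h2 := abs_sub_le_of_sum_sq_le (sqrt_nonneg B)
    (h.trans (by rw [Real.sq_sqrt hB0]; simp [hB])) i
  linarith [abs_le.1 h2, hM i, le_abs_self M]

theorem exists_isRicciFlow_Ici [Fintype 𝒯.Vertex] {Kbar r₀ : 𝒯.Vertex → ℝ}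
    (hr₀ : 𝒯.IsSpherePackingMetric r₀) {M c : ℝ} (hM : 𝒯.IsFlowBound Kbar r₀ M)
    (hc : 0 < c) (hcM : c < M)
    (hKbar : ∀ i, Kbar i ≤ constC₂ (𝒯.eulerChar i) (𝒯.degree i) M c) :
    ∃ δ > 0, ∃ r, 𝒯.IsRicciFlow Kbar r₀ (Ici 0) r ∧ ∀ t ≥ 0, ∀ i, r t i ∈ Icc δ M := by
  obtain ⟨τ₀, hτ₀, r', hr'⟩ := 𝒯.exists_isRicciFlow_Ico Kbar hr₀
  -- `M` bounds solutions only, so that a solution is needed to see that it bounds `r₀`.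
  have hr₀M : ∀ i, r₀ i ≤ M := fun i => by
    have := hM τ₀ r' hr' 0 ⟨le_rfl, hτ₀⟩ i
    rwa [hr'.1] at this
  obtain ⟨δ₀, hδ₀, hr₀δ⟩ := exists_pos_forall_le hr₀.1
  set δ := min δ₀ c with hδdef
  have hδ : 0 < δ := lt_min hδ₀ hc
  have hδc : δ ≤ c := min_le_right _ _
  obtain ⟨r, hr0, hrc, hr⟩ := 𝒯.exists_clamped_flow Kbar r₀ (half_pos hδ) (M := M + 1)
    (by linarith)
  have hmain : ∀ t ≥ 0, r t ∈ Icc (fun _ => δ : 𝒯.Vertex → ℝ) fun _ => M := by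
    refine forall_mem_of_forall_Ico hrc (isOpen_box (δ / 2) (M + 1)) isClosed_Icc
      (fun s hs i => ⟨by linarith [hs.1 i], by linarith [hs.2 i]⟩) ?_ fun τ _ hU => ?_
    · rw [hr0]
      exact fun i => ⟨by linarith [hr₀δ i, min_le_left δ₀ c], by linarith [hr₀M i]⟩
    · have hflow := hr (Ico 0 τ) Ico_subset_Ici_self hU
      have hup := hM τ r hflow
      refine fun t ht => ⟨fun i => ?_, hup t ht⟩
      refine le_of_deriv_nonneg_of_le (fun t ht => (hflow.2 t ht).2 i) hδc ?_ (fun t ht hle => ?_)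
        t ht
      · rw [hr0]; exact (min_le_left _ _).trans (hr₀δ i)
      · exact sub_nonneg.2 ((hKbar i).trans (𝒯.constC₂_le_scalarCurvature (hc.trans hcM) hc
          (hflow.2 t ht).1.1 (hup t ht) hle))
  refine ⟨δ, hδ, r, hr _ subset_rfl fun t ht i => ?_, fun t ht i =>
    ⟨(hmain t ht).1 i, (hmain t ht).2 i⟩⟩
  have h := hmain t ht
  exact ⟨by linarith [h.1 i], by linarith [h.2 i]⟩

variable {𝒯}

theorem IsRicciFlow.exists_exp_decay [Fintype 𝒯.Vertex] {Kbar rbar r₀ : 𝒯.Vertex → ℝ}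
    {r : ℝ → 𝒯.Vertex → ℝ} {δ M : ℝ} (hr : 𝒯.IsRicciFlow Kbar r₀ (Ici 0) r)
    (hrbar : 𝒯.IsSpherePackingMetric rbar) (hK : ∀ i, 𝒯.scalarCurvature rbar i = Kbar i)
    (hδ : 0 < δ) (hbox : ∀ t ≥ 0, ∀ i, r t i ∈ Icc δ M) :
    ∃ A > 0, ∃ lam > 0, ∀ t ≥ 0, ∀ i, |r t i - rbar i| ≤ A * exp (-lam * t) := by
  obtain ⟨δ', hδ', h1⟩ := exists_pos_forall_le hrbar.1
  obtain ⟨M', h2⟩ := exists_forall_le rbar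
  obtain ⟨lam, hlam, h⟩ := 𝒯.scalarCurvature_strongly_antitone (M := max M M') (lt_min hδ hδ')
  set B := ∑ i, (r₀ i - rbar i) ^ 2
  have hB0 : 0 ≤ B := Finset.sum_nonneg fun _ _ => sq_nonneg _
  -- `√B` itself could vanish, and `A` has to be positive.
  refine ⟨√B + 1, by positivity, lam, hlam, fun t ht i => ?_⟩
  have hsum := hr.sum_sq_sub_le (convex_Ici 0) (mem_Ici.2 le_rfl) (isRicciFlow_const hrbar hK _)
    (fun t ht => h rbar (r t)
      (fun i => ⟨(min_le_right _ _).trans (h1 i), (h2 i).trans (le_max_right _ _)⟩)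
      (fun i => ⟨(min_le_left _ _).trans (hbox t ht i).1,
        (hbox t ht i).2.trans (le_max_left _ _)⟩)) (mem_Ici.2 ht) ht
  have hsq : (√B * exp (-lam * t)) ^ 2 = exp (-(2 * lam * t)) * B := by
    rw [mul_pow, Real.sq_sqrt hB0, ← Real.exp_nat_mul]
    push_cast
    ring_nf
  refine (abs_sub_le_of_sum_sq_le (by positivity) (hsum.trans hsq.ge) i).trans ?_
  gcongr
  linarith

end IdealTriangulation

theorem theorem1p5 {T : Type*} [Fintype T] (𝒯 : IdealTriangulation T)
    (Kbar rbar r₀ : 𝒯.Vertex → ℝ)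
    (hrbar : 𝒯.IsSpherePackingMetric rbar)
    (hKbar : ∀ i, 𝒯.scalarCurvature rbar i = Kbar i)
    (hr₀ : 𝒯.IsSpherePackingMetric r₀) :
    -- the flow starting at `r₀` has a solution for short time, and solutions are unique
    ((∃ τ > 0, ∃ r, 𝒯.IsRicciFlow Kbar r₀ (Set.Ico 0 τ) r) ∧
      ∀ τ r r', 𝒯.IsRicciFlow Kbar r₀ (Set.Ico 0 τ) r → 𝒯.IsRicciFlow Kbar r₀ (Set.Ico 0 τ) r' →
        ∀ t ∈ Set.Ico 0 τ, r t = r' t) ∧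
    -- (a) the solution is bounded above by a constant
    (∃ M > 0, 𝒯.IsFlowBound Kbar r₀ M) ∧
    -- (b) for every such bound `M`: long time existence and exponential convergence
    (∀ M > 0, 𝒯.IsFlowBound Kbar r₀ M → ∀ c ∈ Set.Ioo 0 M,
      (∀ i, constC₁ (𝒯.eulerChar i) (𝒯.degree i) M < constC₂ (𝒯.eulerChar i) (𝒯.degree i) M c) ∧
      ((∀ i, Kbar i ∈ Set.Ioc (constC₁ (𝒯.eulerChar i) (𝒯.degree i) M)
          (constC₂ (𝒯.eulerChar i) (𝒯.degree i) M c)) →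
        ∃ r, 𝒯.IsRicciFlow Kbar r₀ (Set.Ici 0) r ∧
          ∃ A > 0, ∃ lam > 0, ∀ t ≥ 0, ∀ i, |r t i - rbar i| ≤ A * exp (-lam * t))) := by
  classical
  let _ := Fintype.ofFinite 𝒯.Vertex
  refine ⟨⟨𝒯.exists_isRicciFlow_Ico Kbar hr₀, fun τ r r' hr hr' t ht => hr.eq_of_mem hr' ht⟩,
    𝒯.exists_isFlowBound hrbar hKbar r₀, fun M _ hM c hc => ⟨fun i => ?_, fun hK => ?_⟩⟩
  · exact constC₁_lt_constC₂ _ (𝒯.degree_pos i) hc.1 hc.2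
  · obtain ⟨δ, hδ, r, hr, hbox⟩ := 𝒯.exists_isRicciFlow_Ici hr₀ hM hc.1 hc.2 fun i => (hK i).2
    exact ⟨r, hr, hr.exists_exp_decay hrbar hKbar hδ hbox⟩
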